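/- All graphs are simple, with non-empty vertex set, possibly infinite or disconnected. A graph $G$ is regarded as a metric graph: every edge is identified with the interval $[0,1]$, the points of $G$ are its vertices and the points of its edges, and $d_G$ is the shortest-path distance ($\infty$ between different components). A geodesic triangle is a triple of geodesics $[x_1x_2],[x_2x_3],[x_3x_1]$ joining three points. The hyperbolicity constant $\delta(G)\in[0,\infty]$ is the infimum of all $\delta\ge 0$ such that, in every geodesic triangle of $G$, each point of each side is at distance at most $\delta$ from the union of the other two sides. Let $\operatorname{diam} G$ be the supremum of $d_G(x,y)$ over all points $x,y$ of the metric graph $G$ (not only its vertices), so $\operatorname{diam} G=\infty$ if $G$ is disconnected, and let $\operatorname{diam}^* G:=\sup_j \operatorname{diam} G_j$, where $\{G_j\}$ are the connected components of $G$. Let $E_1$ be the graph with exactly one vertex; an edgeless graph is a graph without edges. The graph join $G_1\uplus G_2$ of two graphs with disjoint vertex sets is obtained from $G_1\cup G_2$ by adding all edges between a vertex of $G_1$ and a vertex of $G_2$. Theorem. Let $G_1,G_2$ be any two graphs. (1) Assume that $G_1\simeq E_1$. Then $\delta(G_1\uplus G_2)=1$ if and only if $1<\operatorname{diam}^* G_2\le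 2$. (2) Assume that $G_1$ and $G_2$ have at least two vertices each. Then $\delta(G_1\uplus G_2)=1$ if and only if, for each $i\in\{1,2\}$, $\operatorname{diam} G_i\le 2$ or $G_i$ is edgeless. -/

import Mathlib

open scoped ENNReal

noncomputable section

namespace SimpleGraph

universe u v

/-- The graph join on the disjoint union of the vertex sets: the edges of both graphs, together with
all edges between the two vertex sets. -/
def graphJoin {V : Type u} {W : Type v} (G : SimpleGraph V) (H : SimpleGraph W) :
    SimpleGraph (V ⊕ W) where
  Adj
    | Sum.inl a, Sum.inl b => G.Adj a b
    | Sum.inr a, Sum.inr b => H.Adj a b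
    | Sum.inl _, Sum.inr _ => True
    | Sum.inr _, Sum.inl _ => True
  symm := ⟨by
    rintro (a | a) (b | b) h
    · exact G.adj_symm h
    · trivial
    · trivial
    · exact H.adj_symm h⟩
  loopless := ⟨by
    rintro (a | a) h
    · exact G.loopless.irrefl a h
    · exact H.loopless.irrefl a h⟩

open Classical in
/-- `G.InCell a b x`: the pair `a, b` is a vertex (`a = b`) or an edge of `G`, and the function `x`
lies on the straight segment between the unit vectors of `a` and `b`. -/
def InCell {V : Type u} (G : SimpleGraph V) (a b : V) (x : V → ℝ) : Prop :=
  (a = b ∨ G.Adj a b) ∧ x ∈ segment ℝ (Pi.single a (1 : ℝ)) (Pi.single b (1 : ℝ))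

/-- The points of the metric graph of `G`, in barycentric coordinates: the vertices of `G` (unit
vectors), and the points `(1 - t) • a + t • b` of the edges `[a, b]`, every edge being identified
with `[0, 1]`. -/
structure Realization {V : Type u} (G : SimpleGraph V) : Type u where
  coord : V → ℝ
  exists_inCell : ∃ a b, G.InCell a b coord

/-- The lengths of the candidates for a shortest path between two points of the metric graph:
the piece of an edge between two points of the same edge (or vertex), and the paths that leave
`x` along an edge to an endpoint `a` of it, follow a shortest walk of `G` from `a` to `b`, and reach
`y` along an edge with endpoint `b`. A point in the cell `[a, a']` has distance `1 - coord a` from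
`a` along that cell. -/
def Realization.routeLengths {V : Type u} {G : SimpleGraph V} (x y : G.Realization) : Set ℝ≥0∞ :=
  {r | (∃ a b, G.InCell a b x.coord ∧ G.InCell a b y.coord ∧
          r = ENNReal.ofReal |x.coord a - y.coord a|) ∨
       (∃ a a' b b', G.InCell a a' x.coord ∧ G.InCell b b' y.coord ∧
          r = ENNReal.ofReal (1 - x.coord a) + (G.edist a b : ℝ≥0∞)
            + ENNReal.ofReal (1 - y.coord b))}

section InCell

variable {V : Type u} {G : SimpleGraph V} {a b c d : V} {x y : V → ℝ}

theorem InCell.symm (h : G.InCell a b x) : G.InCell b a x := by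
  refine ⟨h.1.imp Eq.symm fun h => G.adj_symm h, ?_⟩
  rw [segment_symm]; exact h.2

theorem InCell.eq_one (h : G.InCell a a x) : x a = 1 := by
  obtain ⟨-, h⟩ := h
  rw [segment_same] at h
  rw [Set.mem_singleton_iff.1 h]; simp

theorem InCell.add_eq_one (h : G.InCell a b x) (hab : a ≠ b) : x a + x b = 1 := by
  obtain ⟨-, s, t, hs, ht, hst, rfl⟩ := h
  simp [hab, hab.symm, hst]

theorem InCell.eq_zero (h : G.InCell a b x) (ha : c ≠ a) (hb : c ≠ b) : x c = 0 := by
  obtain ⟨-, s, t, hs, ht, hst, rfl⟩ := h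
  simp [ha, hb]

theorem InCell.nonneg (h : G.InCell a b x) (c : V) : 0 ≤ x c := by
  classical
  obtain ⟨-, s, t, hs, ht, hst, rfl⟩ := h
  simp only [Pi.add_apply, Pi.smul_apply, Pi.single_apply, smul_eq_mul]
  positivity

theorem InCell.le_one (h : G.InCell a b x) : x a ≤ 1 := by
  by_cases hab : a = b
  · subst hab; exact h.eq_one.le
  · linarith [h.add_eq_one hab, h.nonneg b]

theorem InCell.abs_sub (hx : G.InCell a b x) (hy : G.InCell a b y) :
    |x a - y a| = |x b - y b| := by
  by_cases hab : a = b
  · subst hab; rfl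
  · have h1 := hx.add_eq_one hab
    have h2 := hy.add_eq_one hab
    rw [show x a - y a = -(x b - y b) by linarith, abs_neg]

/-- Two cells through a point coincide, or the point is a common endpoint of them. -/
theorem InCell.eq_or (h : G.InCell a b x) (h' : G.InCell c d x) :
    (a = c ∧ b = d) ∨ (a = d ∧ b = c) ∨ ∃ p, (p = a ∨ p = b) ∧ (p = c ∨ p = d) ∧ x p = 1 := by
  have key : ∀ {a b c d : V}, G.InCell a b x → G.InCell c d x → x a = 1 →
      ∃ p, (p = a ∨ p = b) ∧ (p = c ∨ p = d) ∧ x p = 1 := by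
    intro a b c d _ h' h1
    refine ⟨a, Or.inl rfl, ?_, h1⟩
    by_contra hn
    push Not at hn
    have := h'.eq_zero hn.1 hn.2
    linarith
  by_cases hab : a = b
  · subst hab
    exact Or.inr (Or.inr (key h h' h.eq_one))
  by_cases hcd : c = d
  · subst hcd
    obtain ⟨p, h1, h2, h3⟩ := key h' h h'.eq_one
    exact Or.inr (Or.inr ⟨p, h2, h1, h3⟩)
  have s1 := h.add_eq_one hab
  by_cases ha : a = c ∨ a = d
  · by_cases hb : b = c ∨ b = d
    · rcases ha with rfl | rfl <;> rcases hb with rfl | rfl <;> simp_all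
    · push Not at hb
      have := h'.eq_zero hb.1 hb.2
      exact Or.inr (Or.inr (key h h' (by linarith)))
  · push Not at ha
    have := h'.eq_zero ha.1 ha.2
    obtain ⟨p, h1, h2⟩ := key h.symm h' (by linarith)
    exact Or.inr (Or.inr ⟨p, h1.symm, h2⟩)

theorem InCell.edist_le_one (h : G.InCell a b x) : (G.edist a b : ℝ≥0∞) ≤ 1 := by
  have h1 : G.edist a b ≤ 1 := edist_le_one_iff_adj_or_eq.2 h.1.symm
  exact_mod_cast h1

theorem edist_triangle_ennreal (a b c : V) :
    (G.edist a c : ℝ≥0∞) ≤ G.edist a b + G.edist b c := by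
  exact_mod_cast G.edist_triangle

/-- If a point of the cell `[a, b]` is the vertex `p`, then `p` is no further from `a` in the graph
than along the cell. -/
theorem InCell.edist_le_of_eq_one (h : G.InCell a b x) {p : V} (hp : x p = 1) :
    (G.edist p a : ℝ≥0∞) ≤ ENNReal.ofReal (1 - x a) := by
  by_cases hpa : p = a
  · subst hpa; simp
  · have hpb : p = b := by
      by_contra hpb
      have := h.eq_zero hpa hpb
      linarith
    subst hpb
    have := h.add_eq_one (Ne.symm hpa)
    rw [show 1 - x a = 1 by linarith, ENNReal.ofReal_one]
    exact h.symm.edist_le_one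

theorem InCell.edist_le (h : G.InCell a b x) (h' : G.InCell c d x) :
    (G.edist a c : ℝ≥0∞) ≤ ENNReal.ofReal (1 - x a) + ENNReal.ofReal (1 - x c) := by
  rcases h.eq_or h' with ⟨rfl, rfl⟩ | ⟨rfl, rfl⟩ | ⟨p, -, -, h1⟩
  · simp
  · by_cases hab : a = b
    · subst hab; simp
    · have := h.add_eq_one hab
      rw [← ENNReal.ofReal_add (by linarith [h.le_one]) (by linarith [h'.le_one]),
        show 1 - x a + (1 - x b) = 1 by linarith, ENNReal.ofReal_one]
      exact h.edist_le_one
  · refine (edist_triangle_ennreal a p c).trans (add_le_add ?_ (h'.edist_le_of_eq_one h1))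
    rw [G.edist_comm]
    exact h.edist_le_of_eq_one h1

theorem InCell.exists_end (hx : G.InCell a b x) (hy : G.InCell a b y) (h' : G.InCell c d y) :
    ∃ p q, G.InCell p q x ∧ ENNReal.ofReal (1 - x p) + (G.edist p c : ℝ≥0∞) ≤
      ENNReal.ofReal |x a - y a| + ENNReal.ofReal (1 - y c) := by
  have key : ∀ {a b : V}, G.InCell a b x → G.InCell a b y → (a = c ∨ y a = 1) →
      ∃ p q, G.InCell p q x ∧ ENNReal.ofReal (1 - x p) + (G.edist p c : ℝ≥0∞) ≤
      ENNReal.ofReal |x a - y a| + ENNReal.ofReal (1 - y c) := by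
    intro a b hx hy h
    refine ⟨a, b, hx, ?_⟩
    rcases h with rfl | h
    · rw [edist_self, ENat.toENNReal_zero, add_zero,
        ← ENNReal.ofReal_add (abs_nonneg _) (by linarith [hy.le_one])]
      exact ENNReal.ofReal_le_ofReal (by linarith [neg_abs_le (x a - y a)])
    · refine add_le_add (ENNReal.ofReal_le_ofReal ?_) (h'.edist_le_of_eq_one h)
      linarith [neg_abs_le (x a - y a)]
  rcases hy.eq_or h' with ⟨h1, -⟩ | ⟨-, h1⟩ | ⟨p, rfl | rfl, -, h1⟩
  · exact key hx hy (Or.inl h1)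
  · rw [hx.abs_sub hy]
    exact key hx.symm hy.symm (Or.inl h1)
  · exact key hx hy (Or.inr h1)
  · rw [hx.abs_sub hy]
    exact key hx.symm hy.symm (Or.inr h1)

end InCell

namespace Realization

variable {V : Type u} {G : SimpleGraph V}

theorem routeLengths_symm {x y : G.Realization} {r : ℝ≥0∞} (h : r ∈ x.routeLengths y) :
    r ∈ y.routeLengths x := by
  rcases h with ⟨a, b, h1, h2, rfl⟩ | ⟨a, a', b, b', h1, h2, rfl⟩
  · exact Or.inl ⟨a, b, h2, h1, by rw [abs_sub_comm]⟩
  · refine Or.inr ⟨b, b', a, a', h2, h1, ?_⟩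
    rw [G.edist_comm]
    ring

theorem exists_routeLengths_le {x y z : G.Realization} {r s : ℝ≥0∞} (hr : r ∈ x.routeLengths y)
    (hs : s ∈ y.routeLengths z) : ∃ t ∈ x.routeLengths z, t ≤ r + s := by
  have key : ∀ {x y z : G.Realization} {a b c c' d d' : V}, G.InCell a b x.coord →
      G.InCell a b y.coord → G.InCell c c' y.coord → G.InCell d d' z.coord →
      ∃ t ∈ x.routeLengths z, t ≤ ENNReal.ofReal |x.coord a - y.coord a| +
        (ENNReal.ofReal (1 - y.coord c) + (G.edist c d : ℝ≥0∞)
          + ENNReal.ofReal (1 - z.coord d)) := by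
    intro x y z a b c c' d d' h1 h2 h3 h4
    obtain ⟨p, q, h5, h6⟩ := h1.exists_end h2 h3
    refine ⟨_, Or.inr ⟨p, q, d, d', h5, h4, rfl⟩, ?_⟩
    rw [← add_assoc, ← add_assoc]
    refine add_le_add ?_ le_rfl
    calc ENNReal.ofReal (1 - x.coord p) + (G.edist p d : ℝ≥0∞)
        ≤ ENNReal.ofReal (1 - x.coord p) + ((G.edist p c : ℝ≥0∞) + G.edist c d) := by
          gcongr; exact edist_triangle_ennreal p c d
      _ ≤ _ := by
          rw [← add_assoc]
          exact add_le_add h6 le_rfl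
  rcases hr with ⟨a, b, h1, h2, rfl⟩ | ⟨a, a', b, b', h1, h2, rfl⟩ <;>
  rcases hs with ⟨c, d, h3, h4, rfl⟩ | ⟨c, c', d, d', h3, h4, rfl⟩
  · rcases h2.eq_or h3 with ⟨rfl, rfl⟩ | ⟨rfl, rfl⟩ | ⟨p, hp, hp', h5⟩
    · refine ⟨_, Or.inl ⟨a, b, h1, h4, rfl⟩, ?_⟩
      rw [← ENNReal.ofReal_add (abs_nonneg _) (abs_nonneg _)]
      exact ENNReal.ofReal_le_ofReal (abs_sub_le _ _ _)
    · refine ⟨_, Or.inl ⟨a, b, h1, h4.symm, rfl⟩, ?_⟩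
      rw [h3.abs_sub h4, ← ENNReal.ofReal_add (abs_nonneg _) (abs_nonneg _)]
      exact ENNReal.ofReal_le_ofReal (abs_sub_le _ _ _)
    · have e1 : ∃ q, G.InCell p q x.coord ∧
          |x.coord a - y.coord a| = |x.coord p - y.coord p| := by
        rcases hp with rfl | rfl
        · exact ⟨b, h1, rfl⟩
        · exact ⟨a, h1.symm, h1.abs_sub h2⟩
      have e2 : ∃ q, G.InCell p q z.coord ∧
          |y.coord c - z.coord c| = |y.coord p - z.coord p| := by
        rcases hp' with rfl | rfl
        · exact ⟨d, h4, rfl⟩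
        · exact ⟨c, h4.symm, h3.abs_sub h4⟩
      obtain ⟨q, hq, e1⟩ := e1
      obtain ⟨q', hq', e2⟩ := e2
      refine ⟨_, Or.inr ⟨p, q, p, q', hq, hq', rfl⟩, ?_⟩
      rw [e1, e2, h5, edist_self, ENat.toENNReal_zero, add_zero]
      gcongr
      · linarith [neg_abs_le (x.coord p - 1)]
      · exact le_abs_self _
  · exact key h1 h2 h3 h4
  · obtain ⟨t, ht, hle⟩ := key h4 h3 h2 h1
    refine ⟨t, routeLengths_symm ht, hle.trans (le_of_eq ?_)⟩
    rw [abs_sub_comm, G.edist_comm]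
    ring
  · refine ⟨_, Or.inr ⟨a, a', d, d', h1, h4, rfl⟩, ?_⟩
    calc _ ≤ ENNReal.ofReal (1 - x.coord a) + ((G.edist a b : ℝ≥0∞) +
          (ENNReal.ofReal (1 - y.coord b) + ENNReal.ofReal (1 - y.coord c)) + G.edist c d) +
          ENNReal.ofReal (1 - z.coord d) := by
          gcongr
          refine (edist_triangle_ennreal a b d).trans ?_
          rw [add_assoc]
          gcongr
          refine (edist_triangle_ennreal b c d).trans ?_
          gcongr
          exact h2.edist_le h3
      _ = _ := by ring

/-- The path distance of the metric graph of `G`, with value `∞` between different components. -/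
instance : PseudoEMetricSpace G.Realization where
  edist x y := sInf (x.routeLengths y)
  edist_self x := by
    obtain ⟨a, b, h⟩ := x.exists_inCell
    exact le_antisymm (sInf_le (Or.inl ⟨a, b, h, h, by simp⟩)) zero_le
  edist_comm x y := by
    rw [show x.routeLengths y = y.routeLengths x from
      Set.ext fun r => ⟨routeLengths_symm, routeLengths_symm⟩]
  edist_triangle x y z := by
    rw [sInf_eq_iInf' (x.routeLengths y), sInf_eq_iInf' (y.routeLengths z), ENNReal.iInf_add]
    refine le_iInf fun r => ?_
    rw [ENNReal.add_iInf]
    refine le_iInf fun s => ?_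
    obtain ⟨t, ht, hle⟩ := exists_routeLengths_le r.2 s.2
    exact (sInf_le ht).trans hle

end Realization

/-- The diameter of the metric graph of `G` (over all its points, not only over the vertices). -/
def metricDiam {V : Type u} (G : SimpleGraph V) : ℝ≥0∞ :=
  Metric.ediam (Set.univ : Set G.Realization)

/-- `diam*`: the supremum of the diameters of the connected components. -/
def metricDiamStar {V : Type u} (G : SimpleGraph V) : ℝ≥0∞ :=
  ⨆ C : G.ConnectedComponent, C.toSimpleGraph.metricDiam

end SimpleGraph

namespace GromovHyperbolic

/-- `S` is (the image of) a geodesic from `x` to `y`. -/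
def IsGeodesicSegment {X : Type*} [PseudoEMetricSpace X] (x y : X) (S : Set X) : Prop :=
  ∃ (a b : ℝ) (γ : ℝ → X), a ≤ b ∧ γ a = x ∧ γ b = y ∧ S = γ '' Set.Icc a b ∧
    ∀ s ∈ Set.Icc a b, ∀ t ∈ Set.Icc a b, edist (γ s) (γ t) = ENNReal.ofReal |s - t|

/-- The family of sides `T` is a geodesic triangle. -/
def IsGeodesicTriangle {X : Type*} [PseudoEMetricSpace X] (T : Fin 3 → Set X) : Prop :=
  ∃ x : Fin 3 → X, ∀ i, IsGeodesicSegment (x i) (x (i + 1)) (T i)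

/-- Every point of a side of the polygon `J` is within distance `δ` of the union of the others. -/
def IsThin {X : Type*} [PseudoEMetricSpace X] {n : ℕ} (J : Fin n → Set X) (δ : ℝ≥0∞) : Prop :=
  ∀ i, ∀ x ∈ J i, Metric.infEDist x (⋃ j ∈ {j | j ≠ i}, J j) ≤ δ

/-- The sharp thin constant of a polygon. -/
def thinConst {X : Type*} [PseudoEMetricSpace X] {n : ℕ} (J : Fin n → Set X) : ℝ≥0∞ :=
  sInf {δ | IsThin J δ}

/-- The sharp hyperbolicity constant of `X`. The points of a geodesic triangle are at finite
distance from each other, so for a disconnected graph this is the supremum of the constants of the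
components. -/
def hypConst (X : Type*) [PseudoEMetricSpace X] : ℝ≥0∞ :=
  ⨆ (T : Fin 3 → Set X) (_ : IsGeodesicTriangle T), thinConst T

end GromovHyperbolic

/-- The hyperbolicity constant of the metric graph of `G`. -/
def SimpleGraph.hypConst {V : Type*} (G : SimpleGraph V) : ℝ≥0∞ :=
  GromovHyperbolic.hypConst G.Realization

end

/-! The upper bounds rest on one remark: on a geodesic of length at most `2R` every point is within
`R` of an endpoint, and the endpoints of a side of a triangle also lie on the other sides. So
diameter at most `2R` gives hyperbolicity constant at most `R`. A cone needs a refinement, because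
points over different components of the base may be more than 2 apart; but every geodesic between
them runs through the cone point `v`, and so does another side of the triangle. The same remark then
applies to the two pieces cut off at `v` (`hypConst_le_of_cut`).

The lower bounds come from geodesic bigons in short cycles. A 4-cycle, chords allowed, forces the
constant to be at least 1 (`one_le_hypConst_of_fourCycle`); a 5-cycle with a vertex not adjacent to
either end of the opposite edge forces at least 5/4 (`one_lt_hypConst_of_fiveCycle`).

Both sides meet in a combinatorial reading of the diameters. For a graph with an edge, diameter at
most 2 means that there are no isolated vertices and every vertex equals or neighbours an end of
each edge. For `diam*` at most 2 the same nearness is required along walks of three edges, and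
`diam*` at most 1 forbids paths of two edges. When such a condition fails, the other factor of the
join closes the offending configuration to one of the two cycles. When `diam*` of the base of a cone
is at most 1, the pieces of the cone are edges and triangles, of diameter at most 3/2, and the
constant is at most 3/4. -/

namespace GromovHyperbolic

/-! ### Geodesics and upper bounds for the hyperbolicity constant -/

variable {X : Type*} [PseudoEMetricSpace X] {x y z p v : X} {S S' : Set X} {L L' : ℝ}

theorem IsGeodesicSegment.left_mem (h : IsGeodesicSegment x y S) : x ∈ S := by
  obtain ⟨a, b, γ, hab, rfl, rfl, rfl, -⟩ := h
  exact ⟨a, ⟨le_rfl, hab⟩, rfl⟩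

theorem IsGeodesicSegment.right_mem (h : IsGeodesicSegment x y S) : y ∈ S := by
  obtain ⟨a, b, γ, hab, rfl, rfl, rfl, -⟩ := h
  exact ⟨b, ⟨hab, le_rfl⟩, rfl⟩

theorem IsGeodesicSegment.edist_ne_top (h : IsGeodesicSegment x y S) : edist x y ≠ ∞ := by
  obtain ⟨a, b, γ, hab, rfl, rfl, rfl, h⟩ := h
  rw [h a ⟨le_rfl, hab⟩ b ⟨hab, le_rfl⟩]
  exact ENNReal.ofReal_ne_top

theorem IsGeodesicSegment.edist_add (h : IsGeodesicSegment x y S) (hp : p ∈ S) :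
    edist x p + edist p y = edist x y := by
  obtain ⟨a, b, γ, hab, rfl, rfl, rfl, h⟩ := h
  obtain ⟨t, ht, rfl⟩ := hp
  rw [h a ⟨le_rfl, hab⟩ b ⟨hab, le_rfl⟩, h a ⟨le_rfl, hab⟩ t ht, h t ht b ⟨hab, le_rfl⟩,
    ← ENNReal.ofReal_add (abs_nonneg _) (abs_nonneg _), abs_of_nonpos (by linarith [ht.1]),
    abs_of_nonpos (by linarith [ht.2]), abs_of_nonpos (by linarith)]
  congr 1; ring

theorem IsGeodesicSegment.exists_edist_eq (h : IsGeodesicSegment x y S)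
    (hv : edist x y = edist x v + edist v y) :
    ∃ w ∈ S, edist x w = edist x v ∧ edist w y = edist v y := by
  have hfin := h.edist_ne_top
  have hadd := fun p hp => h.edist_add (p := p) hp
  obtain ⟨a, b, γ, hab, rfl, rfl, rfl, h⟩ := h
  have h1 : edist (γ a) v ≠ ∞ := fun h => hfin (by rw [hv, h, top_add])
  have h2 : edist (γ a) (γ b) = ENNReal.ofReal (b - a) := by
    rw [h a ⟨le_rfl, hab⟩ b ⟨hab, le_rfl⟩, abs_of_nonpos (by linarith)]
    congr 1; ring
  have h3 : (edist (γ a) v).toReal ≤ b - a := by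
    refine ENNReal.toReal_le_of_le_ofReal (by linarith) ?_
    rw [← h2, hv]
    exact le_self_add
  have h0 : 0 ≤ (edist (γ a) v).toReal := ENNReal.toReal_nonneg
  have hm : a + (edist (γ a) v).toReal ∈ Set.Icc a b := ⟨by linarith, by linarith⟩
  have hw : edist (γ a) (γ (a + (edist (γ a) v).toReal)) = edist (γ a) v := by
    rw [h a ⟨le_rfl, hab⟩ _ hm, abs_of_nonpos (by linarith)]
    rw [show -(a - (a + (edist (γ a) v).toReal)) = (edist (γ a) v).toReal by ring,
      ENNReal.ofReal_toReal h1]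
  refine ⟨_, ⟨_, hm, rfl⟩, hw, ?_⟩
  have := hadd _ ⟨_, hm, rfl⟩
  rw [hv, hw] at this
  exact (ENNReal.add_right_inj h1).1 this

/-- A space in which long geodesics have to pass through the point `v`. The relation `D` says that
`v` separates two points. -/
theorem hypConst_le_of_cut (v : X) (D : X → X → Prop) (R : ℝ≥0∞)
    (hsymm : ∀ x y, D x y → D y x) (htrans : ∀ x y z, D x y → D x z ∨ D z y)
    (hD : ∀ x y, D x y → edist x y = edist x v + edist v y)
    (hv : ∀ x, edist x v ≤ R + R) (hR : ∀ x y, ¬ D x y → edist x y ≤ R + R) :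
    hypConst X ≤ R := by
  have half : ∀ {a b : ℝ≥0∞}, a + b ≤ R + R → a ≤ R ∨ b ≤ R := by
    intro a b h
    by_contra! hn
    exact absurd h (not_le.2 (ENNReal.add_lt_add hn.1 hn.2))
  have key : ∀ {x y : X} {S : Set X}, IsGeodesicSegment x y S → D x y →
      ∃ w ∈ S, edist v w = 0 := by
    intro x y S h hxy
    -- The point `w` of the geodesic has the same distances to `x` and `y` as `v`. As `v` separates
    -- `w` from one of them, additivity through `v` leaves no room for a positive distance from `v`
    -- to `w`. In a pseudometric this is all that passing through `v` can mean.
    obtain ⟨w, hw, h1, h2⟩ := h.exists_edist_eq (hD x y hxy)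
    have hfin := h.edist_ne_top
    rw [hD x y hxy] at hfin
    refine ⟨w, hw, ?_⟩
    rcases htrans x y w hxy with h3 | h3
    · have := hD _ _ h3
      rw [h1] at this
      have h5 : edist x v + 0 = edist x v + edist v w := by rw [add_zero]; exact this
      exact ((ENNReal.add_right_inj fun h => hfin (by rw [h, top_add])).1 h5).symm
    · have := hD _ _ h3
      rw [h2] at this
      have h5 : 0 + edist v y = edist w v + edist v y := by rw [zero_add]; exact this
      rw [edist_comm]
      exact ((ENNReal.add_left_inj fun h => hfin (by rw [h, add_top])).1 h5).symm
  refine iSup₂_le fun T hT => sInf_le ?_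
  obtain ⟨x, hx⟩ := hT
  intro i p hp
  have h1 := hx (i + 1)
  have h2 := hx (i + 2)
  have e1 : i + 1 + 1 = i + 2 := by rw [add_assoc]; rfl
  have e2 : i + 2 + 1 = i := by fin_cases i <;> rfl
  rw [e1] at h1
  rw [e2] at h2
  have n1 : i + 1 ≠ i := by fin_cases i <;> decide
  have n2 : i + 2 ≠ i := by fin_cases i <;> decide
  have hsub : ∀ j, j ≠ i → ∀ w ∈ T j, Metric.infEDist p (⋃ j ∈ {j | j ≠ i}, T j) ≤ edist p w :=
    fun j hj w hw => Metric.infEDist_le_edist_of_mem (Set.mem_biUnion (x := j) hj hw)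
  have hl := hsub _ n2 _ h2.right_mem
  have hr := hsub _ n1 _ h1.left_mem
  have hadd := (hx i).edist_add hp
  by_cases hxy : D (x i) (x (i + 1))
  · have hw : ∃ w, edist v w = 0 ∧
        Metric.infEDist p (⋃ j ∈ {j | j ≠ i}, T j) ≤ edist p w := by
      -- The third corner is separated from one end of the side, so another side passes through `v`
      -- too; `v` can thus replace an endpoint in the estimate.
      rcases htrans _ _ (x (i + 2)) hxy with h | h
      · obtain ⟨w, hw, h0⟩ := key h2 (hsymm _ _ h)
        exact ⟨w, h0, hsub _ n2 w hw⟩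
      · obtain ⟨w, hw, h0⟩ := key h1 (hsymm _ _ h)
        exact ⟨w, h0, hsub _ n1 w hw⟩
    obtain ⟨w, h0, hw⟩ := hw
    have hpv : Metric.infEDist p (⋃ j ∈ {j | j ≠ i}, T j) ≤ edist p v :=
      hw.trans ((edist_triangle p v w).trans (by rw [h0, add_zero]))
    have hfin := (hx i).edist_ne_top
    have hxy' := hD _ _ hxy
    rw [hxy'] at hfin hadd
    -- If `v` separates `p` from one end, then `p` lies on the piece between `v` and the other end.
    -- That piece has length at most `2R`, and both its ends are at distance zero from the other
    -- sides.
    rcases htrans _ _ p hxy with h | h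
    · rw [hD _ _ h, add_assoc, ENNReal.add_right_inj fun h => hfin (by rw [h, top_add])] at hadd
      have : edist v p + edist p (x (i + 1)) ≤ R + R := by
        rw [hadd, edist_comm]; exact hv _
      rcases half this with h | h
      · exact hpv.trans (by rwa [edist_comm])
      · exact hr.trans h
    · rw [hD _ _ h, ← add_assoc,
        ENNReal.add_left_inj fun h => hfin (by rw [h, add_top])] at hadd
      rcases half (hadd.trans_le (hv _)) with h | h
      · exact hl.trans (by rwa [edist_comm])
      · exact hpv.trans h
  · rcases half (hadd.trans_le (hR _ _ hxy)) with h | h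
    · exact hl.trans (by rwa [edist_comm])
    · exact hr.trans h

theorem hypConst_le_of_edist_le [Nonempty X] (R : ℝ≥0∞) (h : ∀ x y : X, edist x y ≤ R + R) :
    hypConst X ≤ R :=
  hypConst_le_of_cut (Classical.arbitrary X) (fun _ _ => False) R (fun _ _ h => h)
    (fun _ _ _ h => h.elim) (fun _ _ h => h.elim) (fun x => h x _) fun x y _ => h x y

/-! ### Lipschitz paths, bigons and lower bounds -/

/-- `S` is the image of a 1-Lipschitz path from `x` to `y` with domain of length `L`. -/
def IsLipschitzPath (x y : X) (S : Set X) (L : ℝ) : Prop :=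
  0 ≤ L ∧ ∃ γ : ℝ → X, γ 0 = x ∧ γ L = y ∧ S = γ '' Set.Icc 0 L ∧
    ∀ s ∈ Set.Icc 0 L, ∀ t ∈ Set.Icc 0 L, s ≤ t → edist (γ s) (γ t) ≤ ENNReal.ofReal (t - s)

theorem IsLipschitzPath.trans (h : IsLipschitzPath x y S L) (h' : IsLipschitzPath y z S' L') :
    IsLipschitzPath x z (S ∪ S') (L + L') := by
  obtain ⟨hL, γ, rfl, hy, rfl, h⟩ := h
  obtain ⟨hL', γ', h0, rfl, rfl, h'⟩ := h'
  have hγ' : ∀ t, L ≤ t → (if t ≤ L then γ t else γ' (t - L)) = γ' (t - L) := by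
    intro t ht
    split_ifs with h1
    · rw [le_antisymm h1 ht, hy, sub_self, h0]
    · rfl
  refine ⟨by linarith, fun t => if t ≤ L then γ t else γ' (t - L), if_pos hL, ?_, ?_, ?_⟩
  · beta_reduce
    rw [hγ' _ (by linarith), add_sub_cancel_left]
  · ext w
    constructor
    · rintro (⟨t, ht, rfl⟩ | ⟨t, ht, rfl⟩)
      · exact ⟨t, ⟨ht.1, by linarith [ht.2]⟩, if_pos ht.2⟩
      · refine ⟨L + t, ⟨by linarith [ht.1], by linarith [ht.2]⟩, ?_⟩
        beta_reduce
        rw [hγ' _ (by linarith [ht.1]), add_sub_cancel_left]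
    · rintro ⟨t, ht, rfl⟩
      rcases le_total t L with h1 | h1
      · exact Or.inl ⟨t, ⟨ht.1, h1⟩, (if_pos h1).symm⟩
      · exact Or.inr ⟨t - L, ⟨by linarith, by linarith [ht.2]⟩, (hγ' t h1).symm⟩
  · intro s hs t ht hst
    beta_reduce
    rcases le_total t L with h1 | h1
    · rw [if_pos h1, if_pos (hst.trans h1)]
      exact h s ⟨hs.1, hst.trans h1⟩ t ⟨ht.1, h1⟩ hst
    · rw [hγ' t h1]
      rcases le_total s L with h2 | h2
      · rw [if_pos h2]
        refine (edist_triangle _ y _).trans ?_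
        have e1 := h s ⟨hs.1, h2⟩ L ⟨hL, le_rfl⟩ h2
        have e2 := h' 0 ⟨le_rfl, hL'⟩ (t - L) ⟨by linarith, by linarith [ht.2]⟩ (by linarith)
        rw [hy] at e1
        rw [h0] at e2
        refine (add_le_add e1 e2).trans ?_
        rw [← ENNReal.ofReal_add (by linarith) (by linarith)]
        exact ENNReal.ofReal_le_ofReal (by linarith)
      · rw [hγ' s h2]
        refine (h' (s - L) ⟨by linarith, by linarith [hs.2]⟩ (t - L)
          ⟨by linarith, by linarith [ht.2]⟩ (by linarith)).trans (le_of_eq ?_)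
        congr 1; ring

/-- A shortcut between two parameters would, by the triangle inequality, make the endpoints closer
than `L`. Hence a concatenation of edges is geodesic as soon as its two endpoints are far enough
apart. -/
theorem IsLipschitzPath.isGeodesicSegment (h : IsLipschitzPath x y S L)
    (hL : ENNReal.ofReal L ≤ edist x y) : IsGeodesicSegment x y S := by
  obtain ⟨h0, γ, rfl, rfl, rfl, h⟩ := h
  have key : ∀ s ∈ Set.Icc 0 L, ∀ t ∈ Set.Icc 0 L, s ≤ t →
      edist (γ s) (γ t) = ENNReal.ofReal (t - s) := by
    intro s hs t ht hst
    refine le_antisymm (h s hs t ht hst) ?_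
    have h1 := h 0 ⟨le_rfl, h0⟩ s hs hs.1
    have h2 := h t ht L ⟨h0, le_rfl⟩ ht.2
    have h3 : ENNReal.ofReal L ≤ ENNReal.ofReal (s - 0) + edist (γ s) (γ t) +
        ENNReal.ofReal (L - t) :=
      hL.trans ((edist_triangle4 _ (γ s) (γ t) _).trans (add_le_add (add_le_add h1 le_rfl) h2))
    have h4 : edist (γ s) (γ t) ≠ ∞ := ((h s hs t ht hst).trans_lt ENNReal.ofReal_lt_top).ne
    rw [← ENNReal.ofReal_toReal h4] at h3 ⊢
    rw [← ENNReal.ofReal_add (by linarith [hs.1]) ENNReal.toReal_nonneg,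
      ← ENNReal.ofReal_add (by linarith [hs.1, ENNReal.toReal_nonneg (a := edist (γ s) (γ t))])
        (by linarith [ht.2]),
      ENNReal.ofReal_le_ofReal_iff
        (by linarith [hs.1, ht.2, ENNReal.toReal_nonneg (a := edist (γ s) (γ t))])] at h3
    exact ENNReal.ofReal_le_ofReal (by linarith)
  refine ⟨0, L, γ, h0, rfl, rfl, rfl, fun s hs t ht => ?_⟩
  rcases le_total s t with hst | hst
  · rw [key s hs t ht hst, abs_of_nonpos (by linarith), neg_sub]
  · rw [edist_comm, key t ht s hs hst, abs_of_nonneg (by linarith)]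

theorem isGeodesicSegment_singleton (x : X) : IsGeodesicSegment x x {x} :=
  ⟨0, 0, fun _ => x, le_rfl, rfl, rfl, by simp, fun s hs t ht => by
    have h1 : s = 0 := le_antisymm hs.2 hs.1
    have h2 : t = 0 := le_antisymm ht.2 ht.1
    simp [h1, h2]⟩

theorem IsLipschitzPath.right_mem (h : IsLipschitzPath x y S L) : y ∈ S := by
  obtain ⟨h0, γ, rfl, rfl, rfl, h⟩ := h
  exact ⟨L, ⟨h0, le_rfl⟩, rfl⟩

theorem IsLipschitzPath.symm (h : IsLipschitzPath x y S L) : IsLipschitzPath y x S L := by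
  obtain ⟨h0, γ, rfl, rfl, rfl, h⟩ := h
  refine ⟨h0, fun t => γ (L - t), by simp, by simp, ?_, ?_⟩
  · ext w
    constructor
    · rintro ⟨t, ht, rfl⟩
      exact ⟨L - t, ⟨by linarith [ht.2], by linarith [ht.1]⟩, by simp⟩
    · rintro ⟨t, ht, rfl⟩
      exact ⟨L - t, ⟨by linarith [ht.2], by linarith [ht.1]⟩, rfl⟩
  · intro s hs t ht hst
    rw [edist_comm]
    refine (h (L - t) ⟨by linarith [ht.2], by linarith [ht.1]⟩ (L - s)
      ⟨by linarith [hs.2], by linarith [hs.1]⟩ (by linarith)).trans (le_of_eq ?_)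
    congr 1; ring

/-- The hyperbolicity constant is bounded below by a geodesic bigon. -/
theorem le_hypConst_of_bigon {r : ℝ≥0∞} (h : IsLipschitzPath x y S L)
    (h' : IsLipschitzPath x y S' L) (hL : ENNReal.ofReal L ≤ edist x y) (hp : p ∈ S)
    (hr : ∀ z ∈ S', r ≤ edist p z) : r ≤ hypConst X := by
  -- The degenerate third side `{x}` lies in `S'` and does not bring `p` closer to the other sides.
  have hT : IsGeodesicTriangle ![S, S', {x}] := by
    refine ⟨![x, y, x], fun i => ?_⟩
    fin_cases i
    · exact h.isGeodesicSegment hL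
    · exact h'.symm.isGeodesicSegment (by rwa [edist_comm])
    · exact isGeodesicSegment_singleton x
  refine le_iSup₂_of_le _ hT (le_sInf fun δ hδ => le_trans ?_ (hδ 0 p hp))
  rw [Metric.le_infEDist]
  intro z hz
  obtain ⟨i, hi, hz⟩ := Set.mem_iUnion₂.1 hz
  fin_cases i
  · exact absurd rfl hi
  · exact hr z hz
  · obtain rfl : z = x := hz
    exact hr z h'.symm.right_mem

end GromovHyperbolic

/-! ### Distances between points of the metric graph -/

namespace SimpleGraph

variable {V : Type*} {G : SimpleGraph V} {a b c d v : V}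

theorem one_le_edist_of_ne (h : a ≠ b) : (1 : ℝ≥0∞) ≤ G.edist a b := by
  have : (1 : ℕ∞) ≤ G.edist a b := Order.one_le_iff_pos.2 (edist_pos_of_ne h)
  exact_mod_cast this

theorem two_le_edist_of_not_adj (h : a ≠ b) (h' : ¬ G.Adj a b) : (2 : ℝ≥0∞) ≤ G.edist a b := by
  have h1 : (1 : ℕ∞) < G.edist a b := by
    by_contra! hn
    rcases edist_le_one_iff_adj_or_eq.1 hn with h2 | h2 <;> contradiction
  have : (2 : ℕ∞) ≤ G.edist a b := by
    have := Order.add_one_le_of_lt h1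
    rwa [one_add_one_eq_two] at this
  exact_mod_cast this

/-- `b` lies in the closed neighbourhood of `a`. -/
def Near (G : SimpleGraph V) (a b : V) : Prop := a = b ∨ G.Adj a b

theorem Near.symm (h : G.Near a b) : G.Near b a := h.imp Eq.symm fun h => G.adj_symm h

theorem Near.edist_le (h : G.Near a b) : (G.edist a b : ℝ≥0∞) ≤ 1 := by
  have : G.edist a b ≤ 1 := edist_le_one_iff_adj_or_eq.2 (Or.symm h)
  exact_mod_cast this

theorem two_le_edist_of_not_near (h : ¬ G.Near a b) : (2 : ℝ≥0∞) ≤ G.edist a b :=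
  two_le_edist_of_not_adj (fun e => h (Or.inl e)) fun e => h (Or.inr e)

theorem InCell.eq_or_eq {x : V → ℝ} (h : G.InCell a b x) (hx : x c ≠ 0) : c = a ∨ c = b := by
  by_contra! hn
  exact hx (h.eq_zero hn.1 hn.2)

theorem InCell.near {x : V → ℝ} (h : G.InCell a b x) (hc : x c ≠ 0) (hd : x d ≠ 0) :
    G.Near c d := by
  rcases h.eq_or_eq hc with rfl | rfl <;> rcases h.eq_or_eq hd with rfl | rfl
  · exact Or.inl rfl
  · exact h.1
  · exact h.symm.1
  · exact Or.inl rfl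

theorem InCell.of_near {x : V → ℝ} (h : G.InCell a a x) (hab : G.Near a b) : G.InCell a b x := by
  refine ⟨hab, ?_⟩
  have := h.2
  rw [segment_same, Set.mem_singleton_iff] at this
  rw [this]
  exact left_mem_segment ..

namespace Realization

variable {x y : G.Realization}

open Classical in
/-- The point at distance `t` from `a` on the edge `[a, b]`, for `t` clamped to `[0, 1]`. -/
noncomputable def edgePoint (h : G.Adj a b) (t : ℝ) : G.Realization where
  coord := (1 - max 0 (min 1 t)) • Pi.single a 1 + max 0 (min 1 t) • Pi.single b 1
  exists_inCell := ⟨a, b, Or.inr h, 1 - max 0 (min 1 t), max 0 (min 1 t),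
    by simp, by simp, by ring, rfl⟩

open Classical in
/-- The vertex `a` as a point of the metric graph. -/
noncomputable def ofVertex (G : SimpleGraph V) (a : V) : G.Realization where
  coord := Pi.single a 1
  exists_inCell := ⟨a, a, Or.inl rfl, left_mem_segment ..⟩

theorem inCell_ofVertex (G : SimpleGraph V) (a : V) : G.InCell a a (ofVertex G a).coord :=
  ⟨Or.inl rfl, left_mem_segment ..⟩

theorem ofVertex_coord_self (G : SimpleGraph V) (a : V) : (ofVertex G a).coord a = 1 := by
  simp [ofVertex]

theorem ofVertex_coord_of_ne (h : b ≠ a) : (ofVertex G a).coord b = 0 := by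
  simp [ofVertex, h]

theorem inCell_edgePoint (h : G.Adj a b) (t : ℝ) : G.InCell a b (edgePoint h t).coord :=
  ⟨Or.inr h, 1 - max 0 (min 1 t), max 0 (min 1 t), by simp, by simp, by ring, rfl⟩

theorem edgePoint_coord_right (h : G.Adj a b) {t : ℝ} (ht : t ∈ Set.Icc (0 : ℝ) 1) :
    (edgePoint h t).coord b = t := by
  simp [edgePoint, h.ne', ht.1, ht.2]

theorem edgePoint_coord_left (h : G.Adj a b) {t : ℝ} (ht : t ∈ Set.Icc (0 : ℝ) 1) :
    (edgePoint h t).coord a = 1 - t := by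
  simp [edgePoint, h.ne, ht.1, ht.2]

theorem edgePoint_zero (h : G.Adj a b) : edgePoint h 0 = ofVertex G a := by
  simp [edgePoint, ofVertex]

theorem edgePoint_one (h : G.Adj a b) : edgePoint h 1 = ofVertex G b := by
  simp [edgePoint, ofVertex]

theorem edgePoint_symm (h : G.Adj a b) {t : ℝ} (ht : t ∈ Set.Icc (0 : ℝ) 1) :
    edgePoint h.symm t = edgePoint h (1 - t) := by
  simp [edgePoint, ht.1, ht.2, add_comm]

/-- A point of full weight in a vertex is that vertex. -/
theorem eq_ofVertex_of_forall (h : ∀ b, b ≠ a → x.coord b = 0) : x = ofVertex G a := by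
  obtain ⟨c, hc⟩ := x
  have : c = (ofVertex G a).coord := by
    obtain ⟨p, q, hpq⟩ := hc
    change ∀ b, b ≠ a → c b = 0 at h
    funext b
    by_cases hb : b = a
    · subst hb
      rw [ofVertex_coord_self]
      by_cases hpb : p = b
      · by_cases hqb : q = b
        · subst hpb hqb; exact hpq.eq_one
        · have h1 := hpq.add_eq_one (fun e => hqb (e ▸ hpb))
          rw [h q hqb, add_zero, hpb] at h1
          exact h1
      · have h0 := h p hpb
        by_cases hpq' : p = q
        · subst hpq'
          have := hpq.eq_one
          linarith
        · have h1 := hpq.add_eq_one hpq'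
          rw [h0, zero_add] at h1
          by_cases hqb : q = b
          · rw [← hqb]; exact h1
          · rw [h q hqb] at h1; norm_num at h1
    · rw [h b hb, ofVertex_coord_of_ne hb]
  subst this
  rfl

theorem edist_le_of_inCell (hx : G.InCell a b x.coord) (hy : G.InCell a b y.coord) :
    EDist.edist x y ≤ ENNReal.ofReal |x.coord a - y.coord a| :=
  sInf_le (Or.inl ⟨a, b, hx, hy, rfl⟩)

theorem edist_le_route (hx : G.InCell a b x.coord) (hy : G.InCell c d y.coord) :
    EDist.edist x y ≤ ENNReal.ofReal (1 - x.coord a) + G.edist a c + ENNReal.ofReal (1 - y.coord c) :=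
  sInf_le (Or.inr ⟨a, b, c, d, hx, hy, rfl⟩)

theorem edist_le_of_near (hx : G.InCell a b x.coord) (hy : G.InCell c d y.coord)
    (h : G.Near a c) :
    EDist.edist x y ≤ ENNReal.ofReal (3 - x.coord a - y.coord c) := by
  refine (edist_le_route hx hy).trans ?_
  rw [show 3 - x.coord a - y.coord c = 1 - x.coord a + 1 + (1 - y.coord c) by ring,
    ENNReal.ofReal_add (by linarith [hx.le_one]) (by linarith [hy.le_one]),
    ENNReal.ofReal_add (by linarith [hx.le_one]) (by norm_num), ENNReal.ofReal_one]
  gcongr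
  exact h.edist_le

theorem edist_le_of_common_end (hx : G.InCell a b x.coord) (hy : G.InCell a d y.coord) :
    EDist.edist x y ≤ ENNReal.ofReal (2 - x.coord a - y.coord a) := by
  refine (edist_le_route hx hy).trans ?_
  rw [show 2 - x.coord a - y.coord a = 1 - x.coord a + (1 - y.coord a) by ring,
    ENNReal.ofReal_add (by linarith [hx.le_one]) (by linarith [hy.le_one])]
  simp

theorem edist_le_one_of_inCell (hx : G.InCell a b x.coord) (hy : G.InCell a b y.coord) :
    EDist.edist x y ≤ 1 := by
  refine (edist_le_of_inCell hx hy).trans ?_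
  rw [ENNReal.ofReal_le_one, abs_le]
  constructor <;> linarith [hx.le_one, hy.le_one, hx.nonneg a, hy.nonneg a]

/-- The routes through `a, c` and through `b, d` have lengths at most `3 - x a - y c` and `3 - x b -
y d`. These sum to 4, so one of them is at most 2. -/
theorem edist_le_two (hx : G.InCell a b x.coord) (hy : G.InCell c d y.coord) (hab : a ≠ b)
    (hcd : c ≠ d) (h : G.Near a c) (h' : G.Near b d) : EDist.edist x y ≤ 2 := by
  have h1 := edist_le_of_near hx hy h
  have h2 := edist_le_of_near hx.symm hy.symm h'
  have e1 := hx.add_eq_one hab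
  have e2 := hy.add_eq_one hcd
  have : (2 : ℝ≥0∞) = ENNReal.ofReal 2 := by simp
  rw [this]
  rcases le_total 1 (x.coord a + y.coord c) with h3 | h3
  · exact h1.trans (ENNReal.ofReal_le_ofReal (by linarith))
  · exact h2.trans (ENNReal.ofReal_le_ofReal (by linarith))

/-- The bound for two edges with endpoint `a` that lie in a triangle. -/
theorem edist_le_three_halves (hx : G.InCell a b x.coord) (hy : G.InCell a d y.coord)
    (hab : a ≠ b) (had : a ≠ d) (h : G.Near b d) : EDist.edist x y ≤ ENNReal.ofReal (3 / 2) := by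
  have h1 := edist_le_of_common_end hx hy
  have h2 := edist_le_of_near hx.symm hy.symm h
  have e1 := hx.add_eq_one hab
  have e2 := hy.add_eq_one had
  -- The route through `a` and the one through `b, d` have bounds `2 - x a - y a` and `1 + x a + y
  -- a`, with sum 3.
  rcases le_total (1 / 2) (x.coord a + y.coord a) with h3 | h3
  · exact h1.trans (ENNReal.ofReal_le_ofReal (by linarith))
  · exact h2.trans (ENNReal.ofReal_le_ofReal (by linarith))

/-- Between a point inside the edge `[a, b]` and a point of another cell `[c, d]`, only the routes
through the endpoints of these cells matter. -/
theorem le_edist {r : ℝ≥0∞} (hx : G.InCell a b x.coord) (ha : x.coord a < 1) (hb : x.coord b < 1)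
    (hy : G.InCell c d y.coord) (hcd : ¬ ((a = c ∧ b = d) ∨ (a = d ∧ b = c)))
    (h : ∀ e f, (e = a ∨ e = b) → (f = c ∨ f = d) →
      r ≤ ENNReal.ofReal (1 - x.coord e) + G.edist e f + ENNReal.ofReal (1 - y.coord f)) :
    r ≤ EDist.edist x y := by
  have hxcell : ∀ {e f}, G.InCell e f x.coord → (a = e ∧ b = f) ∨ (a = f ∧ b = e) := by
    intro e f hef
    rcases hx.eq_or hef with h1 | h1 | ⟨p, rfl | rfl, -, hp⟩
    · exact Or.inl h1
    · exact Or.inr h1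
    · exact absurd hp ha.ne
    · exact absurd hp hb.ne
  refine le_sInf ?_
  rintro s (⟨e, f, hex, hey, rfl⟩ | ⟨e, e', f, f', hex, hfy, rfl⟩)
  · have key : G.InCell a b y.coord ∧
        |x.coord e - y.coord e| = |x.coord a - y.coord a| := by
      rcases hxcell hex with ⟨rfl, rfl⟩ | ⟨rfl, rfl⟩
      · exact ⟨hey, rfl⟩
      · exact ⟨hey.symm, hex.abs_sub hey⟩
    obtain ⟨hya, heq⟩ := key
    rw [heq]
    -- A point `y` in two different cells is a common end `p` of both, so the piece of the edge from
    -- `x` to `y` is itself a route through `p`.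
    rcases hya.eq_or hy with h1 | h1 | ⟨p, hp, hp', h1⟩
    · exact absurd (Or.inl h1) hcd
    · exact absurd (Or.inr h1) hcd
    · refine (h p p hp hp').trans ?_
      have h2 : |x.coord a - y.coord a| = |x.coord p - y.coord p| := by
        rcases hp with rfl | rfl
        · rfl
        · exact hx.abs_sub hya
      rw [h2, h1, edist_self, sub_self]
      simp only [ENat.toENNReal_zero, ENNReal.ofReal_zero, add_zero]
      refine ENNReal.ofReal_le_ofReal ?_
      linarith [neg_abs_le (x.coord p - 1)]
  · have he : e = a ∨ e = b := by
      rcases hxcell hex with ⟨h1, h2⟩ | ⟨h1, h2⟩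
      · exact Or.inl h1.symm
      · exact Or.inr h2.symm
    rcases hy.eq_or hfy with ⟨h1, -⟩ | ⟨-, h1⟩ | ⟨p, hp, -, h1⟩
    · exact h e f he (Or.inl h1.symm)
    · exact h e f he (Or.inr h1.symm)
    · refine (h e p he hp).trans ?_
      rw [h1, sub_self, ENNReal.ofReal_zero, add_zero, add_assoc]
      gcongr
      refine (edist_triangle_ennreal e f p).trans ?_
      gcongr
      rw [G.edist_comm]
      exact hfy.edist_le_of_eq_one h1

open GromovHyperbolic in
theorem isLipschitzPath_edgePoint (h : G.Adj a b) {s t : ℝ} (hs : 0 ≤ s) (hst : s ≤ t)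
    (ht : t ≤ 1) :
    IsLipschitzPath (edgePoint h s) (edgePoint h t) (edgePoint h '' Set.Icc s t) (t - s) := by
  refine ⟨by linarith, fun u => edgePoint h (s + u), by simp, by simp, ?_, ?_⟩
  · ext w
    constructor
    · rintro ⟨u, hu, rfl⟩
      exact ⟨u - s, ⟨by linarith [hu.1], by linarith [hu.2]⟩, by simp⟩
    · rintro ⟨u, hu, rfl⟩
      exact ⟨s + u, ⟨by linarith [hu.1], by linarith [hu.2]⟩, rfl⟩
  · intro u hu u' hu' huu
    refine (edist_le_of_inCell (inCell_edgePoint h _) (inCell_edgePoint h _)).trans (le_of_eq ?_)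
    rw [edgePoint_coord_left h ⟨by linarith [hu.1], by linarith [hu.2]⟩,
      edgePoint_coord_left h ⟨by linarith [hu'.1], by linarith [hu'.2]⟩, abs_of_nonneg (by linarith)]
    congr 1; ring

/-- The distance from a vertex to the midpoint of an edge. -/
theorem le_edist_midpoint (h : G.Adj c d) {r : ℝ≥0∞} (hc : r ≤ G.edist c a)
    (hd : r ≤ G.edist d a) :
    ENNReal.ofReal (1 / 2) + r ≤ EDist.edist (edgePoint h (1 / 2)) (ofVertex G a) := by
  have hI : (1 / 2 : ℝ) ∈ Set.Icc (0 : ℝ) 1 := by norm_num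
  have e1 := edgePoint_coord_left h hI
  have e2 := edgePoint_coord_right h hI
  refine le_edist (inCell_edgePoint h _) (by rw [e1]; norm_num) (by rw [e2]; norm_num)
    (inCell_ofVertex G a) ?_ ?_
  · rintro (⟨h1, h2⟩ | ⟨h1, h2⟩) <;> exact h.ne (h1.trans h2.symm)
  · rintro e f (rfl | rfl) (rfl | rfl) <;>
      rw [ofVertex_coord_self, sub_self, ENNReal.ofReal_zero, add_zero] <;> simp only [e1, e2]
    · norm_num; gcongr
    · norm_num; gcongr
    · norm_num; gcongr
    · norm_num; gcongr

end Realization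

end SimpleGraph

/-! ### Short cycles and the combinatorics of the diameter -/

namespace SimpleGraph

open Realization GromovHyperbolic

variable {V : Type*} {G : SimpleGraph V} {a b c d v : V}

theorem ofReal_zero_le_edist (a b : V) : ENNReal.ofReal 0 ≤ G.edist a b := by simp

theorem ofReal_one_le_edist (h : a ≠ b) : ENNReal.ofReal 1 ≤ G.edist a b := by
  rw [ENNReal.ofReal_one]; exact one_le_edist_of_ne h

theorem ofReal_two_le_edist (h : ¬ G.Near a b) : ENNReal.ofReal 2 ≤ G.edist a b := by
  rw [ENNReal.ofReal_ofNat]; exact two_le_edist_of_not_near h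

/-- A lower bound for the distance between a point inside an edge and a point of another cell, in
terms of lower bounds for the distances between the ends of the two cells. -/
theorem Realization.ofReal_le_edist {x y : G.Realization} {r : ℝ} (k₁ k₂ k₃ k₄ : ℝ)
    (hx : G.InCell a b x.coord) (ha : x.coord a < 1) (hb : x.coord b < 1)
    (hy : G.InCell c d y.coord) (hcd : ¬ ((a = c ∧ b = d) ∨ (a = d ∧ b = c)))
    (h₁ : ENNReal.ofReal k₁ ≤ G.edist a c) (h₂ : ENNReal.ofReal k₂ ≤ G.edist a d)
    (h₃ : ENNReal.ofReal k₃ ≤ G.edist b c) (h₄ : ENNReal.ofReal k₄ ≤ G.edist b d)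
    (h₁' : r ≤ (1 - x.coord a) + k₁ + (1 - y.coord c))
    (h₂' : r ≤ (1 - x.coord a) + k₂ + (1 - y.coord d))
    (h₃' : r ≤ (1 - x.coord b) + k₃ + (1 - y.coord c))
    (h₄' : r ≤ (1 - x.coord b) + k₄ + (1 - y.coord d)) :
    ENNReal.ofReal r ≤ EDist.edist x y := by
  have key : ∀ {e f : V} {k : ℝ}, ENNReal.ofReal k ≤ G.edist e f →
      r ≤ (1 - x.coord e) + k + (1 - y.coord f) →
      ENNReal.ofReal r ≤ ENNReal.ofReal (1 - x.coord e) + G.edist e f +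
        ENNReal.ofReal (1 - y.coord f) := by
    intro e f k hk h
    refine (ENNReal.ofReal_le_ofReal h).trans (ENNReal.ofReal_add_le.trans ?_)
    gcongr
    exact ENNReal.ofReal_add_le.trans (by gcongr)
  refine le_edist hx ha hb hy hcd ?_
  rintro e f (rfl | rfl) (rfl | rfl)
  · exact key h₁ h₁'
  · exact key h₂ h₂'
  · exact key h₃ h₃'
  · exact key h₄ h₄'

/-- A cycle of length four forces the hyperbolicity constant to be at least one. -/
theorem one_le_hypConst_of_fourCycle (hab : G.Adj a b) (hbc : G.Adj b c) (hcd : G.Adj c d)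
    (hda : G.Adj d a) (hac : a ≠ c) (hbd : b ≠ d) : 1 ≤ G.hypConst := by
  have hI : (1 / 2 : ℝ) ∈ Set.Icc (0 : ℝ) 1 := by norm_num
  have p1 := isLipschitzPath_edgePoint hab (s := 1 / 2) (t := 1) (by norm_num) (by norm_num) le_rfl
  have p2 := isLipschitzPath_edgePoint hbc (s := 0) (t := 1) le_rfl zero_le_one le_rfl
  have p3 := isLipschitzPath_edgePoint hcd (s := 0) (t := 1 / 2) le_rfl (by norm_num) (by norm_num)
  have q1 := isLipschitzPath_edgePoint hab.symm (s := 1 / 2) (t := 1) (by norm_num) (by norm_num)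
    le_rfl
  have q2 := isLipschitzPath_edgePoint hda.symm (s := 0) (t := 1) le_rfl zero_le_one le_rfl
  have q3 := isLipschitzPath_edgePoint hcd.symm (s := 0) (t := 1 / 2) le_rfl (by norm_num)
    (by norm_num)
  rw [edgePoint_one] at p1 p2 q1 q2
  rw [edgePoint_zero] at p2 p3 q2 q3
  rw [edgePoint_symm hcd hI, sub_half] at q3
  rw [edgePoint_symm hab hI] at q1
  rw [sub_half] at p1 q1
  have hp := (p1.trans p2).trans p3
  have hq := (q1.trans q2).trans q3
  rw [show 1 / 2 + (1 - 0) + (1 / 2 - 0) = (2 : ℝ) by norm_num] at hp hq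
  have l1 := edgePoint_coord_left hab hI
  have l2 := edgePoint_coord_right hab hI
  have l3 := edgePoint_coord_left hcd hI
  have l4 := edgePoint_coord_right hcd hI
  have l5 := edgePoint_coord_left hda.symm hI
  have l6 := edgePoint_coord_right hda.symm hI
  rw [← ENNReal.ofReal_one]
  -- The bigon joins the midpoints of `[a, b]` and `[c, d]`, at distance 2, and `p` is the midpoint
  -- of `[a, d]`. Only the distinctness of the vertices enters the estimates, so chords are
  -- harmless.
  refine le_hypConst_of_bigon (p := edgePoint hda.symm (1 / 2)) hq hp ?_
    (Or.inl (Or.inr ⟨1 / 2, hI, rfl⟩)) ?_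
  · refine ofReal_le_edist 1 1 1 1 (inCell_edgePoint hab _) ?_ ?_ (inCell_edgePoint hcd _) ?_
      (ofReal_one_le_edist hac) (ofReal_one_le_edist hda.ne') (ofReal_one_le_edist hbc.ne)
      (ofReal_one_le_edist hbd) ?_ ?_ ?_ ?_
    all_goals first | linarith | skip
    rintro (⟨h, -⟩ | ⟨h, -⟩)
    · exact hac h
    · exact hda.ne' h
  · rintro z ((⟨t, ht, rfl⟩ | ⟨t, ht, rfl⟩) | ⟨t, ht, rfl⟩)
    · have ht' : t ∈ Set.Icc (0 : ℝ) 1 := ⟨by linarith [ht.1], ht.2⟩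
      have m1 := edgePoint_coord_left hab ht'
      have m2 := edgePoint_coord_right hab ht'
      refine ofReal_le_edist 0 1 1 1 (inCell_edgePoint hda.symm _) ?_ ?_ (inCell_edgePoint hab _) ?_
        (ofReal_zero_le_edist _ _) (ofReal_one_le_edist hab.ne) (ofReal_one_le_edist hda.ne)
        (ofReal_one_le_edist hbd.symm) ?_ ?_ ?_ ?_
      all_goals first | linarith [ht.1, ht.2] | skip
      rintro (⟨-, h⟩ | ⟨h, -⟩)
      · exact hbd h.symm
      · exact hab.ne h
    · have m1 := edgePoint_coord_left hbc ht
      have m2 := edgePoint_coord_right hbc ht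
      refine ofReal_le_edist 1 1 1 1 (inCell_edgePoint hda.symm _) ?_ ?_ (inCell_edgePoint hbc _) ?_
        (ofReal_one_le_edist hab.ne) (ofReal_one_le_edist hac) (ofReal_one_le_edist hbd.symm)
        (ofReal_one_le_edist hcd.ne') ?_ ?_ ?_ ?_
      all_goals first | linarith [ht.1, ht.2] | skip
      rintro (⟨h, -⟩ | ⟨h, -⟩)
      · exact hab.ne h
      · exact hac h
    · have ht' : t ∈ Set.Icc (0 : ℝ) 1 := ⟨ht.1, by linarith [ht.2]⟩
      have m1 := edgePoint_coord_left hcd ht'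
      have m2 := edgePoint_coord_right hcd ht'
      refine ofReal_le_edist 1 1 1 0 (inCell_edgePoint hda.symm _) ?_ ?_ (inCell_edgePoint hcd _) ?_
        (ofReal_one_le_edist hac) (ofReal_one_le_edist hda.ne') (ofReal_one_le_edist hcd.ne')
        (ofReal_zero_le_edist _ _) ?_ ?_ ?_ ?_
      all_goals first | linarith [ht.1, ht.2] | skip
      rintro (⟨h, -⟩ | ⟨h, -⟩)
      · exact hac h
      · exact hda.ne' h

/-- A cycle `v a b c d` of length five with `a` far from both ends of `[c, d]`. -/
theorem one_lt_hypConst_of_fiveCycle (hva : G.Adj v a) (hab : G.Adj a b) (hbc : G.Adj b c)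
    (hcd : G.Adj c d) (hdv : G.Adj d v) (hac : ¬ G.Near a c) (had : ¬ G.Near a d)
    (hvb : v ≠ b) (hvc : v ≠ c) : 1 < G.hypConst := by
  have hbd : b ≠ d := by rintro rfl; exact had (Or.inr hab)
  have hac' : a ≠ c := fun h => hac (Or.inl h)
  have had' : a ≠ d := fun h => had (Or.inl h)
  have hI : (1 / 2 : ℝ) ∈ Set.Icc (0 : ℝ) 1 := by norm_num
  have hJ : (1 / 4 : ℝ) ∈ Set.Icc (0 : ℝ) 1 := by norm_num
  have p1 := isLipschitzPath_edgePoint hab (s := 0) (t := 1) le_rfl zero_le_one le_rfl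
  have p2 := isLipschitzPath_edgePoint hbc (s := 0) (t := 1) le_rfl zero_le_one le_rfl
  have p3 := isLipschitzPath_edgePoint hcd (s := 0) (t := 1 / 2) le_rfl (by norm_num) (by norm_num)
  have q1 := isLipschitzPath_edgePoint hva.symm (s := 0) (t := 1) le_rfl zero_le_one le_rfl
  have q2 := isLipschitzPath_edgePoint hdv.symm (s := 0) (t := 1) le_rfl zero_le_one le_rfl
  have q3 := isLipschitzPath_edgePoint hcd.symm (s := 0) (t := 1 / 2) le_rfl (by norm_num)
    (by norm_num)
  rw [edgePoint_one] at p1 p2 q1 q2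
  rw [edgePoint_zero] at p1 p2 p3 q1 q2 q3
  rw [edgePoint_symm hcd hI, sub_half] at q3
  have hp := (p1.trans p2).trans p3
  have hq := (q1.trans q2).trans q3
  rw [show (1 : ℝ) - 0 + (1 - 0) + (1 / 2 - 0) = 1 / 2 + 2 by norm_num] at hp hq
  have l5 := edgePoint_coord_left hdv.symm hJ
  have l6 := edgePoint_coord_right hdv.symm hJ
  have main : ENNReal.ofReal (5 / 4) ≤ G.hypConst := by
    -- The bigon joins `a` to the midpoint of `[c, d]`, at distance 5/2. The point `p` of `[v, d]`
    -- at distance 1/4 from `v` balances the way to `a`, of length 1/4 + 1, against the way through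
    -- `d` to that midpoint, of length 3/4 + 1/2. Possible chords from `v` to `b` or `c` also cost
    -- at least 1/4 + 1.
    refine le_hypConst_of_bigon (p := edgePoint hdv.symm (1 / 4)) hq hp ?_
      (Or.inl (Or.inr ⟨1 / 4, hJ, rfl⟩)) ?_
    · rw [ENNReal.ofReal_add (by norm_num) (by norm_num), PseudoEMetricSpace.edist_comm]
      exact le_edist_midpoint hcd (ofReal_two_le_edist fun h => hac h.symm)
        (ofReal_two_le_edist fun h => had h.symm)
    · rintro z ((⟨t, ht, rfl⟩ | ⟨t, ht, rfl⟩) | ⟨t, ht, rfl⟩)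
      · have m1 := edgePoint_coord_left hab ht
        have m2 := edgePoint_coord_right hab ht
        refine ofReal_le_edist 1 1 1 1 (inCell_edgePoint hdv.symm _) ?_ ?_ (inCell_edgePoint hab _)
          ?_ (ofReal_one_le_edist hva.ne) (ofReal_one_le_edist hvb) (ofReal_one_le_edist had'.symm)
          (ofReal_one_le_edist hbd.symm) ?_ ?_ ?_ ?_
        all_goals first | linarith [ht.1, ht.2] | skip
        rintro (⟨h, -⟩ | ⟨h, -⟩)
        · exact hva.ne h
        · exact hvb h
      · have m1 := edgePoint_coord_left hbc ht
        have m2 := edgePoint_coord_right hbc ht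
        refine ofReal_le_edist 1 1 1 1 (inCell_edgePoint hdv.symm _) ?_ ?_ (inCell_edgePoint hbc _)
          ?_ (ofReal_one_le_edist hvb) (ofReal_one_le_edist hvc) (ofReal_one_le_edist hbd.symm)
          (ofReal_one_le_edist hcd.ne') ?_ ?_ ?_ ?_
        all_goals first | linarith [ht.1, ht.2] | skip
        rintro (⟨h, -⟩ | ⟨h, -⟩)
        · exact hvb h
        · exact hvc h
      · have ht' : t ∈ Set.Icc (0 : ℝ) 1 := ⟨ht.1, by linarith [ht.2]⟩
        have m1 := edgePoint_coord_left hcd ht'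
        have m2 := edgePoint_coord_right hcd ht'
        refine ofReal_le_edist 1 1 1 0 (inCell_edgePoint hdv.symm _) ?_ ?_ (inCell_edgePoint hcd _)
          ?_ (ofReal_one_le_edist hvc) (ofReal_one_le_edist hdv.ne') (ofReal_one_le_edist hcd.ne')
          (ofReal_zero_le_edist _ _) ?_ ?_ ?_ ?_
        all_goals first | linarith [ht.1, ht.2] | skip
        rintro (⟨h, -⟩ | ⟨h, -⟩)
        · exact hvc h
        · exact hdv.ne' h
  refine lt_of_lt_of_le ?_ main
  rw [ENNReal.one_lt_ofReal]
  norm_num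

theorem metricDiam_le_iff {R : ℝ≥0∞} :
    G.metricDiam ≤ R ↔ ∀ x y : G.Realization, EDist.edist x y ≤ R := by
  simp [metricDiam, Metric.ediam_le_iff]

/-- In a graph of diameter at most two every vertex is close to every edge. -/
theorem near_of_metricDiam_le_two (h : G.metricDiam ≤ 2) (a : V) (hcd : G.Adj c d) :
    G.Near a c ∨ G.Near a d := by
  by_contra! hn
  have h1 := (le_edist_midpoint hcd (ofReal_two_le_edist fun h => hn.1 h.symm)
    (ofReal_two_le_edist fun h => hn.2 h.symm)).trans (metricDiam_le_iff.1 h _ _)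
  rw [← ENNReal.ofReal_add (by norm_num) (by norm_num), ← ENNReal.ofReal_ofNat,
    ENNReal.ofReal_le_ofReal_iff (by norm_num)] at h1
  norm_num at h1

/-- Otherwise `a` is at distance at least 3/2 from the midpoint of `[b, c]`. -/
theorem eq_of_metricDiam_le_one (h : G.metricDiam ≤ 1) (hab : G.Adj a b) (hbc : G.Adj b c) :
    a = c := by
  by_contra hn
  have h1 := (le_edist_midpoint hbc (ofReal_one_le_edist hab.ne')
    (ofReal_one_le_edist (Ne.symm hn))).trans (metricDiam_le_iff.1 h _ _)
  rw [← ENNReal.ofReal_add (by norm_num) (by norm_num), ← ENNReal.ofReal_one,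
    ENNReal.ofReal_le_ofReal_iff (by norm_num)] at h1
  norm_num at h1

theorem InCell.exists_adj {x : V → ℝ} (h : G.InCell a b x) (he : ∃ c, G.Adj a c) :
    ∃ c, G.Adj a c ∧ G.InCell a c x := by
  rcases h.1 with rfl | h'
  · obtain ⟨c, hc⟩ := he
    exact ⟨c, hc, h.of_near (Or.inr hc)⟩
  · exact ⟨b, h', h⟩

/-- If each of `a, b` is near one of `c, d` and conversely, the ends can be matched in near pairs,
and `edist_le_two` applies. -/
theorem Realization.edist_le_two_of_near {x y : G.Realization} (hx : G.InCell a b x.coord)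
    (hy : G.InCell c d y.coord) (hab : G.Adj a b) (hcd : G.Adj c d)
    (ha : G.Near a c ∨ G.Near a d) (hb : G.Near b c ∨ G.Near b d)
    (hc : G.Near c a ∨ G.Near c b) (hd : G.Near d a ∨ G.Near d b) : EDist.edist x y ≤ 2 := by
  by_cases h : G.Near a c ∧ G.Near b d
  · exact edist_le_two hx hy hab.ne hcd.ne h.1 h.2
  · have : G.Near a d ∧ G.Near b c := by
      have e1 : G.Near c a ↔ G.Near a c := ⟨Near.symm, Near.symm⟩
      have e2 : G.Near d a ↔ G.Near a d := ⟨Near.symm, Near.symm⟩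
      have e3 : G.Near c b ↔ G.Near b c := ⟨Near.symm, Near.symm⟩
      have e4 : G.Near d b ↔ G.Near b d := ⟨Near.symm, Near.symm⟩
      rw [e1, e3] at hc
      rw [e2, e4] at hd
      tauto
    exact edist_le_two hx hy.symm hab.ne hcd.ne' this.1 this.2

/-- Isolated vertices must be excluded: an edgeless graph satisfies the second condition vacuously.
Without them every point lies on a genuine edge. -/
theorem metricDiam_le_two (he : ∀ a, ∃ b, G.Adj a b)
    (h : ∀ a c d, G.Adj c d → G.Near a c ∨ G.Near a d) : G.metricDiam ≤ 2 := by
  rw [metricDiam_le_iff]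
  intro x y
  obtain ⟨a, b, hx⟩ := x.exists_inCell
  obtain ⟨c, d, hy⟩ := y.exists_inCell
  obtain ⟨b, hab, hx⟩ := hx.exists_adj (he a)
  obtain ⟨d, hcd, hy⟩ := hy.exists_adj (he c)
  exact edist_le_two_of_near hx hy hab hcd (h _ _ _ hcd) (h _ _ _ hcd) (h _ _ _ hab) (h _ _ _ hab)

/-- A graph with an edge and of diameter larger than two has a vertex far from some edge. -/
theorem exists_not_near_of_two_lt_metricDiam (h : ¬ G.metricDiam ≤ 2) (hG : G ≠ ⊥) :
    ∃ a c d, G.Adj c d ∧ ¬ G.Near a c ∧ ¬ G.Near a d := by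
  by_contra! hn
  refine h (metricDiam_le_two (fun a => ?_) fun a c d hcd => ?_)
  -- A vertex equal or adjacent to an end of an existing edge is not isolated.
  · obtain ⟨c, d, hcd⟩ := ne_bot_iff_exists_adj.1 hG
    by_cases h1 : G.Near a c
    · rcases h1 with rfl | h1
      · exact ⟨d, hcd⟩
      · exact ⟨c, h1⟩
    · rcases hn a c d hcd h1 with rfl | h2
      · exact ⟨c, hcd.symm⟩
      · exact ⟨d, h2⟩
  · by_contra! h1
    exact h1.2 (hn a c d hcd h1.1)

/-- Nearness to the edge `[c, d]` propagates backwards along a walk: if the next vertex is an end of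
the edge, its predecessor is adjacent to that end; if it is adjacent to an end, the predecessor
starts a walk of three edges ending with `[c, d]`. -/
theorem Reachable.near_or_near (hG : ∀ a b c d, G.Adj a b → G.Adj b c → G.Adj c d →
    G.Near a c ∨ G.Near a d) (h : G.Reachable a c) (hcd : G.Adj c d) :
    G.Near a c ∨ G.Near a d := by
  obtain ⟨w⟩ := h
  induction w with
  | nil => exact Or.inl (Or.inl rfl)
  | cons hadj w ih =>
    rcases ih hcd with (rfl | h) | (rfl | h)
    · exact Or.inl (Or.inr hadj)
    · exact hG _ _ _ _ hadj h hcd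
    · exact Or.inr (Or.inr hadj)
    · exact (hG _ _ _ _ hadj h hcd.symm).symm

theorem Reachable.near (hG : ∀ a b c, G.Adj a b → G.Adj b c → a = c) (h : G.Reachable a c) :
    G.Near a c := by
  obtain ⟨w⟩ := h
  induction w with
  | nil => exact Or.inl rfl
  | cons hadj w ih =>
    rcases ih with rfl | h
    · exact Or.inr hadj
    · exact Or.inl (hG _ _ _ hadj h)

/-- Such a graph is a single vertex or a single edge, so any two points share a cell. -/
theorem Preconnected.metricDiam_le_one (h : G.Preconnected)
    (hG : ∀ a b c, G.Adj a b → G.Adj b c → a = c) : G.metricDiam ≤ 1 := by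
  rw [metricDiam_le_iff]
  intro x y
  obtain ⟨a, b, hx⟩ := x.exists_inCell
  obtain ⟨c, d, hy⟩ := y.exists_inCell
  have near : ∀ a b, G.Near a b := fun a b => (h a b).near hG
  rcases hx.1 with rfl | hab
  · rcases hy.1 with rfl | hcd
    · exact edist_le_one_of_inCell (hx.of_near (near a c)) (hy.of_near (near c a)).symm
    · rcases near a c with rfl | hac
      · exact edist_le_one_of_inCell (hx.of_near (near a d)) hy
      · obtain rfl := hG _ _ _ hac hcd
        exact edist_le_one_of_inCell (hx.of_near (near a c)) hy.symm
  · rcases near a c with rfl | hac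
    · rcases hy.1 with rfl | had
      · exact edist_le_one_of_inCell hx (hy.of_near (near _ b))
      · obtain rfl := hG _ _ _ hab.symm had
        exact edist_le_one_of_inCell hx hy
    · obtain rfl := hG _ _ _ hab.symm hac
      rcases hy.1 with rfl | had
      · exact edist_le_one_of_inCell hx (hy.of_near (near _ a)).symm
      · obtain rfl := hG _ _ _ hab had
        exact edist_le_one_of_inCell hx hy.symm

theorem Preconnected.metricDiam_le_two (h : G.Preconnected)
    (hG : ∀ a b c d, G.Adj a b → G.Adj b c → G.Adj c d → G.Near a c ∨ G.Near a d) :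
    G.metricDiam ≤ 2 := by
  by_cases he : ∀ a, ∃ b, G.Adj a b
  · exact SimpleGraph.metricDiam_le_two he fun a c d hcd => (h a c).near_or_near hG hcd
  · push Not at he
    obtain ⟨p, hp⟩ := he
    have hall : ∀ c, c = p := by
      intro c
      obtain ⟨w⟩ := h p c
      cases w with
      | nil => rfl
      | cons h1 _ => exact absurd h1 (hp _)
    refine (metricDiam_le_iff.2 fun x y => ?_).trans one_le_two
    obtain ⟨a, b, hx⟩ := x.exists_inCell
    obtain ⟨c, d, hy⟩ := y.exists_inCell
    rw [hall a, hall b] at hx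
    rw [hall c, hall d] at hy
    exact edist_le_one_of_inCell hx hy

theorem metricDiamStar_le_one_iff :
    G.metricDiamStar ≤ 1 ↔ ∀ a b c, G.Adj a b → G.Adj b c → a = c := by
  constructor
  · intro h a b c hab hbc
    have hC := (le_iSup (fun C : G.ConnectedComponent => C.toSimpleGraph.metricDiam)
      (G.connectedComponentMk a)).trans h
    have hb : b ∈ G.connectedComponentMk a := ConnectedComponent.sound hab.symm.reachable
    have hc : c ∈ G.connectedComponentMk a :=
      ConnectedComponent.sound (hbc.symm.reachable.trans hab.symm.reachable)
    exact congrArg Subtype.val (eq_of_metricDiam_le_one hC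
      (((G.connectedComponentMk a).toSimpleGraph_adj rfl hb).2 hab)
      (((G.connectedComponentMk a).toSimpleGraph_adj hb hc).2 hbc))
  · intro h
    refine iSup_le fun C => C.connected_toSimpleGraph.preconnected.metricDiam_le_one ?_
    rintro ⟨a, ha⟩ ⟨b, hb⟩ ⟨c, hc⟩ hab hbc
    exact Subtype.ext (h a b c hab hbc)

/-- A walk stays in one component, so the condition can be tested there. Its failure is a path which
the cone point closes to a 5-cycle, just as a failure of `metricDiamStar_le_one_iff` gives a
4-cycle. -/
theorem metricDiamStar_le_two_iff : G.metricDiamStar ≤ 2 ↔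
    ∀ a b c d, G.Adj a b → G.Adj b c → G.Adj c d → G.Near a c ∨ G.Near a d := by
  constructor
  · intro h a b c d hab hbc hcd
    have hC := (le_iSup (fun C : G.ConnectedComponent => C.toSimpleGraph.metricDiam)
      (G.connectedComponentMk a)).trans h
    have hc : c ∈ G.connectedComponentMk a :=
      ConnectedComponent.sound (hbc.symm.reachable.trans hab.symm.reachable)
    have hd : d ∈ G.connectedComponentMk a :=
      ConnectedComponent.sound (hcd.symm.reachable.trans
        (hbc.symm.reachable.trans hab.symm.reachable))
    exact (near_of_metricDiam_le_two hC ⟨a, rfl⟩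
      (((G.connectedComponentMk a).toSimpleGraph_adj hc hd).2 hcd)).imp
      (Or.imp (congrArg Subtype.val) id) (Or.imp (congrArg Subtype.val) id)
  · intro h
    refine iSup_le fun C => C.connected_toSimpleGraph.preconnected.metricDiam_le_two ?_
    rintro ⟨a, ha⟩ ⟨b, hb⟩ ⟨c, hc⟩ ⟨d, hd⟩ hab hbc hcd
    exact (h a b c d hab hbc hcd).imp (Or.imp Subtype.ext id) (Or.imp Subtype.ext id)

end SimpleGraph

namespace SimpleGraph

open Realization GromovHyperbolic

theorem Near.reachable {V : Type*} {G : SimpleGraph V} {a b : V} (h : G.Near a b) : G.Reachable a b := by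
  rcases h with rfl | h
  · exact Reachable.refl _
  · exact h.reachable

/-! ### Joins of two graphs with several vertices -/

section Join

variable {V W : Type*} {G₁ : SimpleGraph V} {G₂ : SimpleGraph W}

theorem graphJoin_adj_inl {a b : V} :
    (G₁.graphJoin G₂).Adj (Sum.inl a) (Sum.inl b) ↔ G₁.Adj a b := Iff.rfl

theorem graphJoin_adj_inr {a b : W} :
    (G₁.graphJoin G₂).Adj (Sum.inr a) (Sum.inr b) ↔ G₂.Adj a b := Iff.rfl

theorem graphJoin_adj_inl_inr (a : V) (b : W) :
    (G₁.graphJoin G₂).Adj (Sum.inl a) (Sum.inr b) := trivial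

theorem graphJoin_adj_inr_inl (a : V) (b : W) :
    (G₁.graphJoin G₂).Adj (Sum.inr b) (Sum.inl a) := trivial

theorem near_graphJoin_inl {a b : V} :
    (G₁.graphJoin G₂).Near (Sum.inl a) (Sum.inl b) ↔ G₁.Near a b := by
  simp [Near, graphJoin_adj_inl]

theorem near_graphJoin_inr {a b : W} :
    (G₁.graphJoin G₂).Near (Sum.inr a) (Sum.inr b) ↔ G₂.Near a b := by
  simp [Near, graphJoin_adj_inr]

theorem one_le_hypConst_graphJoin [Nontrivial V] [Nontrivial W] :
    1 ≤ (G₁.graphJoin G₂).hypConst := by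
  obtain ⟨a, c, hac⟩ := exists_pair_ne V
  obtain ⟨b, d, hbd⟩ := exists_pair_ne W
  exact one_le_hypConst_of_fourCycle (graphJoin_adj_inl_inr a b) (graphJoin_adj_inr_inl c b)
    (graphJoin_adj_inl_inr c d) (graphJoin_adj_inr_inl a d) (Sum.inl_injective.ne hac)
    (Sum.inr_injective.ne hbd)

/-- With a vertex `a` far from an edge `[c, d]` and two vertices `u, w` of the other factor, `u a w
c d` is the required 5-cycle. -/
theorem one_lt_hypConst_graphJoin_left [Nontrivial W] (h : ¬ G₁.metricDiam ≤ 2) (hG : G₁ ≠ ⊥) :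
    1 < (G₁.graphJoin G₂).hypConst := by
  obtain ⟨a, c, d, hcd, hac, had⟩ := exists_not_near_of_two_lt_metricDiam h hG
  obtain ⟨u, w, huw⟩ := exists_pair_ne W
  exact one_lt_hypConst_of_fiveCycle (graphJoin_adj_inr_inl a u) (graphJoin_adj_inl_inr a w)
    (graphJoin_adj_inr_inl c w) (graphJoin_adj_inl.2 hcd) (graphJoin_adj_inl_inr d u)
    (fun h => hac (near_graphJoin_inl.1 h)) (fun h => had (near_graphJoin_inl.1 h))
    (Sum.inr_injective.ne huw) Sum.inr_ne_inl

theorem one_lt_hypConst_graphJoin_right [Nontrivial V] (h : ¬ G₂.metricDiam ≤ 2) (hG : G₂ ≠ ⊥) :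
    1 < (G₁.graphJoin G₂).hypConst := by
  obtain ⟨a, c, d, hcd, hac, had⟩ := exists_not_near_of_two_lt_metricDiam h hG
  obtain ⟨u, w, huw⟩ := exists_pair_ne V
  exact one_lt_hypConst_of_fiveCycle (graphJoin_adj_inl_inr u a) (graphJoin_adj_inr_inl w a)
    (graphJoin_adj_inl_inr w c) (graphJoin_adj_inr.2 hcd) (graphJoin_adj_inr_inl u d)
    (fun h => hac (near_graphJoin_inr.1 h)) (fun h => had (near_graphJoin_inr.1 h))
    (Sum.inl_injective.ne huw) Sum.inl_ne_inr

theorem near_or_near_of_metricDiam_le_two_or_eq_bot (h : G₁.metricDiam ≤ 2 ∨ G₁ = ⊥) (a c d : V)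
    (hcd : G₁.Adj c d) : G₁.Near a c ∨ G₁.Near a d := by
  rcases h with h | rfl
  · exact near_of_metricDiam_le_two h a hcd
  · exact hcd.elim

/-- The whole join has diameter at most 2. An edgeless factor is harmless although its own diameter
may be infinite: it has no edge to be far from, and in the join its vertices are not isolated. -/
theorem hypConst_graphJoin_le_one [Nonempty V] [Nonempty W]
    (h₁ : G₁.metricDiam ≤ 2 ∨ G₁ = ⊥) (h₂ : G₂.metricDiam ≤ 2 ∨ G₂ = ⊥) :
    (G₁.graphJoin G₂).hypConst ≤ 1 := by
  obtain ⟨v⟩ := ‹Nonempty V›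
  obtain ⟨w⟩ := ‹Nonempty W›
  have hdiam : (G₁.graphJoin G₂).metricDiam ≤ 2 := by
    refine metricDiam_le_two ?_ ?_
    · rintro (a | a)
      · exact ⟨Sum.inr w, graphJoin_adj_inl_inr a w⟩
      · exact ⟨Sum.inl v, graphJoin_adj_inr_inl v a⟩
    · rintro (a | a) (c | c) (d | d) hcd
      · simp only [near_graphJoin_inl]
        exact near_or_near_of_metricDiam_le_two_or_eq_bot h₁ a c d hcd
      · exact Or.inr (Or.inr (graphJoin_adj_inl_inr a d))
      · exact Or.inl (Or.inr (graphJoin_adj_inl_inr a c))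
      · exact Or.inl (Or.inr (graphJoin_adj_inl_inr a c))
      · exact Or.inl (Or.inr (graphJoin_adj_inr_inl c a))
      · exact Or.inl (Or.inr (graphJoin_adj_inr_inl c a))
      · exact Or.inr (Or.inr (graphJoin_adj_inr_inl d a))
      · simp only [near_graphJoin_inr]
        exact near_or_near_of_metricDiam_le_two_or_eq_bot h₂ a c d hcd
  have : Nonempty (G₁.graphJoin G₂).Realization := ⟨ofVertex _ (Sum.inl v)⟩
  exact hypConst_le_of_edist_le 1 fun x y => by
    rw [one_add_one_eq_two]; exact metricDiam_le_iff.1 hdiam x y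

end Join

/-! ### Cones over a graph -/

section Cone

variable {V W : Type*} {G₁ : SimpleGraph V} {G₂ : SimpleGraph W}

/-- The cone point separates `x` and `y`: they do not belong to the cone over one component. -/
def ConeSeparated (x y : (G₁.graphJoin G₂).Realization) : Prop :=
  ∀ w w' : W, x.coord (Sum.inr w) ≠ 0 → y.coord (Sum.inr w') ≠ 0 → ¬ G₂.Reachable w w'

/-- A route that avoids `v` as an end of its middle part joins base vertices of different
components. These are at distance at least 2, which is no shorter than the detour through `v`. -/
theorem edist_of_coneSeparated [Subsingleton V] (v : V) {x y : (G₁.graphJoin G₂).Realization} (h : ConeSeparated x y) :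
    EDist.edist x y = EDist.edist x (ofVertex _ (Sum.inl v)) +
      EDist.edist (ofVertex _ (Sum.inl v)) y := by
  have eqv : ∀ z : (G₁.graphJoin G₂).Realization, (∀ w, z.coord (Sum.inr w) = 0) →
      z = ofVertex _ (Sum.inl v) := by
    refine fun z hz => eq_ofVertex_of_forall ?_
    rintro (b | b) hb
    · exact absurd (congrArg Sum.inl (Subsingleton.elim b v)) hb
    · exact hz b
  -- A point without base coordinates is the cone point, which is vacuously separated from every
  -- point.
  by_cases hx : ∀ w, x.coord (Sum.inr w) = 0
  · rw [eqv x hx, PseudoEMetricSpace.edist_self, zero_add]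
  by_cases hy : ∀ w, y.coord (Sum.inr w) = 0
  · rw [eqv y hy, PseudoEMetricSpace.edist_self, add_zero]
  push Not at hx hy
  obtain ⟨w, hw⟩ := hx
  obtain ⟨w', hw'⟩ := hy
  have reach : ∀ {z : (G₁.graphJoin G₂).Realization} {e : W} {e' : V ⊕ W} {u : W},
      (G₁.graphJoin G₂).InCell (Sum.inr e) e' z.coord → z.coord (Sum.inr u) ≠ 0 →
      G₂.Reachable e u := by
    intro z e e' u hz hu
    rcases hz.eq_or_eq hu with h1 | h1
    · rw [Sum.inr_injective h1]
    · subst h1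
      exact Near.reachable (near_graphJoin_inr.1 hz.1)
  have toV : ∀ {z : (G₁.graphJoin G₂).Realization} {e e' : V ⊕ W},
      (G₁.graphJoin G₂).InCell e e' z.coord → EDist.edist z (ofVertex _ (Sum.inl v)) ≤
        ENNReal.ofReal (1 - z.coord e) + (G₁.graphJoin G₂).edist e (Sum.inl v) := by
    intro z e e' hz
    refine (edist_le_route hz (inCell_ofVertex _ (Sum.inl v))).trans (le_of_eq ?_)
    rw [ofVertex_coord_self, sub_self, ENNReal.ofReal_zero, add_zero]
  refine le_antisymm (edist_triangle _ _ _) (le_sInf ?_)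
  rintro r (⟨a, b, hax, hay, rfl⟩ | ⟨a, a', b, b', hax, hby, rfl⟩)
  · exfalso
    rcases a with a | a
    · rcases b with b | b
      · rcases hax.eq_or_eq hw with h1 | h1 <;> exact Sum.inr_ne_inl h1
      · exact h w w' hw hw' ((reach hax.symm hw).symm.trans (reach hay.symm hw'))
    · exact h w w' hw hw' ((reach hax hw).symm.trans (reach hay hw'))
  · have hd : ((G₁.graphJoin G₂).edist a (Sum.inl v) : ℝ≥0∞) +
        (G₁.graphJoin G₂).edist b (Sum.inl v) ≤ (G₁.graphJoin G₂).edist a b := by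
      rcases a with a | a
      · rw [Subsingleton.elim a v, edist_self, ENat.toENNReal_zero, zero_add,
          SimpleGraph.edist_comm]
      · rcases b with b | b
        · rw [Subsingleton.elim b v, edist_self, ENat.toENNReal_zero, add_zero]
        · have hfar : ¬ (G₁.graphJoin G₂).Near (Sum.inr a) (Sum.inr b) := fun hn =>
            h w w' hw hw' ((reach hax hw).symm.trans
              ((near_graphJoin_inr.1 hn).reachable.trans (reach hby hw')))
          refine le_trans ?_ (two_le_edist_of_not_near hfar)
          rw [← one_add_one_eq_two]
          exact add_le_add (Near.edist_le (Or.inr (graphJoin_adj_inr_inl v a)))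
            (Near.edist_le (Or.inr (graphJoin_adj_inr_inl v b)))
    rw [PseudoEMetricSpace.edist_comm (ofVertex _ (Sum.inl v)) y]
    calc _ ≤ _ := add_le_add (toV hax) (toV hby)
      _ = ENNReal.ofReal (1 - x.coord a) + (((G₁.graphJoin G₂).edist a (Sum.inl v) : ℝ≥0∞) +
        (G₁.graphJoin G₂).edist b (Sum.inl v)) + ENNReal.ofReal (1 - y.coord b) := by ring
      _ ≤ _ := by gcongr

/-- Every point is within 1/2 of a vertex, hence within 3/2 of the cone point; this is where 3/4
comes from. -/
theorem hypConst_cone_le [Subsingleton V] (v : V) (R : ℝ) (hR : 3 / 4 ≤ R)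
    (h : ∀ x y : (G₁.graphJoin G₂).Realization, ¬ ConeSeparated x y →
      EDist.edist x y ≤ ENNReal.ofReal (R + R)) :
    (G₁.graphJoin G₂).hypConst ≤ ENNReal.ofReal R := by
  rw [ENNReal.ofReal_add (by linarith) (by linarith)] at h
  refine hypConst_le_of_cut (ofVertex _ (Sum.inl v)) ConeSeparated _ ?_ ?_
    (fun x y => edist_of_coneSeparated v) ?_ h
  · exact fun x y hxy w w' hw hw' hr => hxy w' w hw' hw hr.symm
  · intro x y z hxy
    -- Base vertices carrying weight in the same point `z` are equal or adjacent, so reachability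
    -- can be chained through `z`.
    by_contra! hn
    simp only [ConeSeparated] at hn
    push Not at hn
    obtain ⟨⟨w, w1, hw, hw1, h1⟩, w2, w3, hw2, hw3, h2⟩ := hn
    obtain ⟨p, q, hz⟩ := z.exists_inCell
    exact hxy w w3 hw hw3 (h1.trans ((near_graphJoin_inr.1 (hz.near hw1 hw2)).reachable.trans
      h2))
  · intro x
    rw [← ENNReal.ofReal_add (by linarith) (by linarith)]
    have near : ∀ a, (G₁.graphJoin G₂).Near a (Sum.inl v) := by
      rintro (a | a)
      · exact Or.inl (congrArg _ (Subsingleton.elim a v))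
      · exact Or.inr (graphJoin_adj_inr_inl v a)
    have key : ∀ a b, (G₁.graphJoin G₂).InCell a b x.coord → 1 / 2 ≤ x.coord a →
        EDist.edist x (ofVertex (G₁.graphJoin G₂) (Sum.inl v)) ≤ ENNReal.ofReal (R + R) := by
      intro a b hx ha
      refine (edist_le_of_near hx (inCell_ofVertex _ (Sum.inl v)) (near a)).trans
        (ENNReal.ofReal_le_ofReal ?_)
      rw [ofVertex_coord_self]
      linarith
    obtain ⟨a, b, hx⟩ := x.exists_inCell
    by_cases hab : a = b
    · subst hab
      exact key _ _ hx (by rw [hx.eq_one]; norm_num)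
    · rcases le_total (1 / 2) (x.coord a) with h1 | h1
      · exact key _ _ hx h1
      · exact key _ _ hx.symm (by linarith [hx.add_eq_one hab])

/-- A point that is not the cone point lies in an edge with an end in the base of the cone. -/
theorem exists_inCell_cone (v : V) {x : (G₁.graphJoin G₂).Realization} {w : W}
    (hw : x.coord (Sum.inr w) ≠ 0) :
    (∃ u, (G₁.graphJoin G₂).InCell (Sum.inr w) (Sum.inl u) x.coord) ∨
      ∃ b, G₂.Adj w b ∧ (G₁.graphJoin G₂).InCell (Sum.inr w) (Sum.inr b) x.coord := by
  have key : ∀ q, (G₁.graphJoin G₂).InCell (Sum.inr w) q x.coord →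
      (∃ u, (G₁.graphJoin G₂).InCell (Sum.inr w) (Sum.inl u) x.coord) ∨
      ∃ b, G₂.Adj w b ∧ (G₁.graphJoin G₂).InCell (Sum.inr w) (Sum.inr b) x.coord := by
    rintro (u | b) h
    · exact Or.inl ⟨u, h⟩
    · rcases near_graphJoin_inr.1 h.1 with rfl | hb
      · exact Or.inl ⟨v, h.of_near (Or.inr (graphJoin_adj_inr_inl v w))⟩
      · exact Or.inr ⟨b, hb, h⟩
  obtain ⟨p, q, h⟩ := x.exists_inCell
  rcases h.eq_or_eq hw with rfl | rfl
  · exact key q h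
  · exact key p h.symm

/-- Both points lie on edges of the cone over one component. The ends of two such edges are mutually
near: through the cone vertex, or by `Reachable.near_or_near` in the base. -/
theorem edist_le_two_of_not_coneSeparated (v : V)
    (hG : ∀ a b c d, G₂.Adj a b → G₂.Adj b c → G₂.Adj c d → G₂.Near a c ∨ G₂.Near a d)
    {x y : (G₁.graphJoin G₂).Realization} (h : ¬ ConeSeparated x y) : EDist.edist x y ≤ 2 := by
  simp only [ConeSeparated] at h
  push Not at h
  obtain ⟨w, w', hw, hw', hr⟩ := h
  have nl : ∀ u b, (G₁.graphJoin G₂).Near (Sum.inl u) (Sum.inr b) :=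
    fun u b => Or.inr (graphJoin_adj_inl_inr u b)
  have nr : ∀ u b, (G₁.graphJoin G₂).Near (Sum.inr b) (Sum.inl u) :=
    fun u b => Or.inr (graphJoin_adj_inr_inl u b)
  have nn : ∀ {a c d : W}, G₂.Reachable a c → G₂.Adj c d →
      (G₁.graphJoin G₂).Near (Sum.inr a) (Sum.inr c) ∨
        (G₁.graphJoin G₂).Near (Sum.inr a) (Sum.inr d) := by
    intro a c d h hcd
    simp only [near_graphJoin_inr]
    exact h.near_or_near hG hcd
  rcases exists_inCell_cone v hw with ⟨u, hx⟩ | ⟨b, hb, hx⟩ <;>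
    rcases exists_inCell_cone v hw' with ⟨u', hy⟩ | ⟨b', hb', hy⟩
  · exact edist_le_two_of_near hx hy (graphJoin_adj_inr_inl u w) (graphJoin_adj_inr_inl u' w')
      (Or.inr (nr _ _)) (Or.inl (nl _ _)) (Or.inr (nr _ _)) (Or.inl (nl _ _))
  · exact edist_le_two_of_near hx hy (graphJoin_adj_inr_inl u w) (graphJoin_adj_inr.2 hb')
      (nn hr hb') (Or.inl (nl _ _)) (Or.inr (nr _ _)) (Or.inr (nr _ _))
  · exact edist_le_two_of_near hx hy (graphJoin_adj_inr.2 hb) (graphJoin_adj_inr_inl u' w')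
      (Or.inr (nr _ _)) (Or.inr (nr _ _)) (nn hr.symm hb) (Or.inl (nl _ _))
  · exact edist_le_two_of_near hx hy (graphJoin_adj_inr.2 hb) (graphJoin_adj_inr.2 hb')
      (nn hr hb') (nn (hb.symm.reachable.trans hr) hb') (nn hr.symm hb)
      (nn (hb'.symm.reachable.trans hr.symm) hb)

/-- The cone over a vertex or an edge is an edge or a triangle. In each case below the two cells are
given a common end. -/
theorem edist_le_three_halves_of_not_coneSeparated [Subsingleton V] (v : V)
    (hG : ∀ a b c, G₂.Adj a b → G₂.Adj b c → a = c)
    {x y : (G₁.graphJoin G₂).Realization} (h : ¬ ConeSeparated x y) :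
    EDist.edist x y ≤ ENNReal.ofReal (3 / 2) := by
  simp only [ConeSeparated] at h
  push Not at h
  obtain ⟨w, w', hw, hw', hr⟩ := h
  have nl : ∀ u b, (G₁.graphJoin G₂).Near (Sum.inl u) (Sum.inr b) :=
    fun u b => Or.inr (graphJoin_adj_inl_inr u b)
  have ne : ∀ {a b : W}, G₂.Adj a b → (Sum.inr a : V ⊕ W) ≠ Sum.inr b :=
    fun h => Sum.inr_injective.ne h.ne
  rcases hr.near hG with rfl | hww
  · rcases exists_inCell_cone v hw with ⟨u, hx⟩ | ⟨b, hb, hx⟩ <;>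
      rcases exists_inCell_cone v hw' with ⟨u', hy⟩ | ⟨b', hb', hy⟩
    · exact edist_le_three_halves hx hy Sum.inr_ne_inl Sum.inr_ne_inl
        (Or.inl (congrArg _ (Subsingleton.elim u u')))
    · exact edist_le_three_halves hx hy Sum.inr_ne_inl (ne hb') (nl _ _)
    · exact edist_le_three_halves hx hy (ne hb) Sum.inr_ne_inl (nl _ _).symm
    · exact edist_le_three_halves hx hy (ne hb) (ne hb')
        (Or.inl (congrArg _ (hG _ _ _ hb.symm hb')))
  · rcases exists_inCell_cone v hw with ⟨u, hx⟩ | ⟨b, hb, hx⟩ <;>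
      rcases exists_inCell_cone v hw' with ⟨u', hy⟩ | ⟨b', hb', hy⟩
    · rw [Subsingleton.elim u' u] at hy
      exact edist_le_three_halves hx.symm hy.symm Sum.inl_ne_inr Sum.inl_ne_inr
        (near_graphJoin_inr.2 (Or.inr hww))
    · obtain rfl := hG _ _ _ hww hb'
      exact edist_le_three_halves hx hy.symm Sum.inr_ne_inl (ne hww) (nl _ _)
    · obtain rfl := hG _ _ _ hww.symm hb
      exact edist_le_three_halves hx.symm hy (ne hww.symm) Sum.inr_ne_inl (nl _ _).symm
    · obtain rfl := hG _ _ _ hww.symm hb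
      obtain rfl := hG _ _ _ hww hb'
      exact edist_le_three_halves hx hy.symm (ne hww) (ne hww) (Or.inl rfl)

theorem hypConst_cone_eq_one_iff [Subsingleton V] (v : V) :
    (G₁.graphJoin G₂).hypConst = 1 ↔ 1 < G₂.metricDiamStar ∧ G₂.metricDiamStar ≤ 2 := by
  constructor
  · intro h
    constructor
    · by_contra hn
      rw [not_lt, metricDiamStar_le_one_iff] at hn
      have h1 : (G₁.graphJoin G₂).hypConst ≤ ENNReal.ofReal (3 / 4) :=
        hypConst_cone_le v (3 / 4) le_rfl fun x y hxy => by
          rw [show (3 / 4 + 3 / 4 : ℝ) = 3 / 2 by norm_num]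
          exact edist_le_three_halves_of_not_coneSeparated v hn hxy
      rw [h, ← ENNReal.ofReal_one, ENNReal.ofReal_le_ofReal_iff (by norm_num)] at h1
      norm_num at h1
    · by_contra hn
      rw [metricDiamStar_le_two_iff] at hn
      push Not at hn
      obtain ⟨a, b, c, d, hab, hbc, hcd, hac, had⟩ := hn
      refine (one_lt_hypConst_of_fiveCycle (G := G₁.graphJoin G₂) (graphJoin_adj_inl_inr v a)
        (graphJoin_adj_inr.2 hab) (graphJoin_adj_inr.2 hbc) (graphJoin_adj_inr.2 hcd)
        (graphJoin_adj_inr_inl v d) (fun h => hac (near_graphJoin_inr.1 h))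
        (fun h => had (near_graphJoin_inr.1 h)) Sum.inl_ne_inr Sum.inl_ne_inr).ne' h
  · rintro ⟨h1, h2⟩
    refine le_antisymm ?_ ?_
    · rw [metricDiamStar_le_two_iff] at h2
      rw [← ENNReal.ofReal_one]
      refine hypConst_cone_le v 1 (by norm_num) fun x y hxy => ?_
      rw [one_add_one_eq_two, ENNReal.ofReal_ofNat]
      exact edist_le_two_of_not_coneSeparated v h2 hxy
    · rw [← not_le, metricDiamStar_le_one_iff] at h1
      push Not at h1
      obtain ⟨a, b, c, hab, hbc, hac⟩ := h1
      exact one_le_hypConst_of_fourCycle (graphJoin_adj_inl_inr v a) (graphJoin_adj_inr.2 hab)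
        (graphJoin_adj_inr.2 hbc) (graphJoin_adj_inr_inl v c) Sum.inl_ne_inr
        (Sum.inr_injective.ne hac)

end Cone

end SimpleGraph

theorem mainTheorem7 {V W : Type*} [Nonempty V] [Nonempty W]
    (G₁ : SimpleGraph V) (G₂ : SimpleGraph W) :
    (Nonempty (G₁ ≃g SimpleGraph.emptyGraph (Fin 1)) →
      ((G₁.graphJoin G₂).hypConst = 1 ↔ 1 < G₂.metricDiamStar ∧ G₂.metricDiamStar ≤ 2)) ∧
    (Nontrivial V → Nontrivial W →
      ((G₁.graphJoin G₂).hypConst = 1 ↔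
        (G₁.metricDiam ≤ 2 ∨ G₁ = ⊥) ∧ (G₂.metricDiam ≤ 2 ∨ G₂ = ⊥))) := by
  refine ⟨?_, fun hV hW => ⟨fun h => ⟨?_, ?_⟩, fun h => ?_⟩⟩
  · rintro ⟨φ⟩
    have : Subsingleton V := φ.toEquiv.injective.subsingleton
    exact SimpleGraph.hypConst_cone_eq_one_iff (Classical.arbitrary V)
  · by_contra! hn
    exact (SimpleGraph.one_lt_hypConst_graphJoin_left (not_le.2 hn.1) hn.2).ne' h
  · by_contra! hn
    exact (SimpleGraph.one_lt_hypConst_graphJoin_right (not_le.2 hn.1) hn.2).ne' h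
  · exact le_antisymm (SimpleGraph.hypConst_graphJoin_le_one h.1 h.2)
      SimpleGraph.one_le_hypConst_graphJoin
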